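/- Let $a<b$ be real, let $n,d\in\mathbb N$, and let $P_0,\dots,P_n\in\mathbb R^{d\times d}$ satisfy $P_j^{\top}=(-1)^{j+1}P_j$ for all $j$ and $\det P_n\neq 0$. Let $\mathcal H\in L_\infty(a,b;\mathbb R^{d\times d})$ be such that $\mathcal H(x)$ is symmetric for almost every $x$ and, for some $c>0$, $\langle \mathcal H(x)v,v\rangle\ge c\|v\|^2$ for almost every $x$ and all $v\in\mathbb R^d$. Let $H=L_2(a,b)^d$ with the inner product $\langle u,v\rangle_H=\int_a^b\langle\mathcal H(x)u(x),v(x)\rangle\,dx$, and let $A$ be the operator $$Au=\sum_{k=0}^n P_k\,\partial^k(\mathcal H u),\qquad \operatorname{dom}(A)=\{u\in H:\ \mathcal H u\in H^n(a,b)^d\},$$ where $\partial$ is the weak derivative and $H^n(a,b)$ the $L_2$-Sobolev space of order $n$. For $t\in[a,b]$ and $v\in H^n(a,b)^d$ let $\operatorname{tr}_t v=(v(t),v'(t),\dots,v^{(n-1)}(t))\in\mathbb R^{nd}$, the values being those of the continuous representatives. Let $Q\in\mathbb R^{nd\times nd}$ be the (symmetric, invertible) block matrix whose $d\times d$ block in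 row $i$ and column $j$ ($1\le i,j\le n$) is $(-1)^{i+1}P_{i+j-1}$ if $i+j-1\le n$ and $0$ otherwise. Let $E_+$ (resp. $E_-$) be the linear span of the eigenvectors of $Q$ for positive (resp. negative) eigenvalues, let $\iota_\pm\colon E_\pm\to\mathbb R^{nd}$ be the embeddings, and put $Q_+=\iota_+(\iota_+^*Q\iota_+)^{1/2}\iota_+^*$ and $Q_-=\iota_-(\iota_-^*(-Q)\iota_-)^{1/2}\iota_-^*$. A possibly nonlinear mapping $B\colon\operatorname{dom}(B)\subseteq H\to H$ is called m-accretive if $\langle B(u)-B(v),u-v\rangle_H\ge 0$ for all $u,v\in\operatorname{dom}(B)$ and $1+B\colon\operatorname{dom}(B)\to H$ is onto. Let $B\subseteq A$ be any (possibly nonlinear) restriction of $A$, i.e. $\operatorname{dom}(B)$ is an arbitrary subset of $\operatorname{dom}(A)$ and $B(u)=Au$ for $u\in\operatorname{dom}(B)$. Then $B$ is m-accretive if and only if there is a map $g\colon\mathbb R^{nd}\to\mathbb R^{nd}$ with $\|g(x)-g(y)\|\le\|x-y\|$ for all $x,y\in\mathbb R^{nd}$ (Euclidean norm) such that $$\operatorname{dom}(B)=\{u\in\operatorname{dom}(A):\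 g(Q_+\operatorname{tr}_b\mathcal H u+Q_-\operatorname{tr}_a\mathcal H u)=Q_-\operatorname{tr}_b\mathcal H u+Q_+\operatorname{tr}_a\mathcal H u\}.$$ -/

import Mathlib

open MeasureTheory Set
open scoped ContDiff ENNReal

noncomputable section

namespace PortHamiltonian

/-! ### m-accretive (possibly nonlinear) operators -/

/-- A (possibly nonlinear, partially defined) operator `B : dom(B) ⊆ E → E` is accretive with
respect to the inner product `ip` if `ip (B u - B v) (u - v) ≥ 0` for all `u, v ∈ dom(B)`. -/
def IsAccretive {E : Type*} [AddCommGroup E] (ip : E → E → ℝ) (B : E →. E) : Prop :=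
  ∀ (u v : E) (hu : u ∈ B.Dom) (hv : v ∈ B.Dom), 0 ≤ ip (B.fn u hu - B.fn v hv) (u - v)

/-- `B` is m-accretive with respect to the inner product `ip` if it is accretive and
`1 + B : dom(B) → E` is onto. -/
def IsMAccretive {E : Type*} [AddCommGroup E] (ip : E → E → ℝ) (B : E →. E) : Prop :=
  IsAccretive ip B ∧ ∀ f : E, ∃ (u : E) (hu : u ∈ B.Dom), u + B.fn u hu = f

/-- `B ⊆ A`: the operator `B` is a restriction of the operator `A`. -/
def IsRestriction {E : Type*} (B A : E →. E) : Prop :=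
  ∀ (u : E) (hu : u ∈ B.Dom), ∃ hu' : u ∈ A.Dom, B.fn u hu = A.fn u hu'

/-! ### Sobolev functions on `(a, b)` with values in `ℝ^d` -/

/-- Lebesgue measure on the open interval `(a, b)`. -/
abbrev intervalMeasure (a b : ℝ) : Measure ℝ := volume.restrict (Ioo a b)

/-- The space `L₂(a,b)^d`. -/
abbrev L2 (a b : ℝ) (d : ℕ) : Type := Lp (EuclideanSpace ℝ (Fin d)) 2 (intervalMeasure a b)

/-- `g` is the weak derivative of order `k` of `f` on `(a, b)`:
`∫ φ^(k) f = (-1)^k ∫ φ g` for all `φ ∈ C_c^∞(a,b)`. (It is only used for `f`, `g` in `L₂`.) -/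
def IsWeakDeriv {d : ℕ} (a b : ℝ) (k : ℕ) (f g : ℝ → EuclideanSpace ℝ (Fin d)) : Prop :=
  ∀ φ : ℝ → ℝ, ContDiff ℝ ∞ φ → HasCompactSupport φ → tsupport φ ⊆ Ioo a b →
    ∫ x in Ioo a b, iteratedDeriv k φ x • f x = (-1 : ℝ) ^ k • ∫ x in Ioo a b, φ x • g x

/-- The Sobolev space `H^n(a,b)^d`: all `f ∈ L₂(a,b)^d` whose weak derivatives of order `≤ n`
exist and belong to `L₂(a,b)^d`. -/
def MemSobolev {d : ℕ} (a b : ℝ) (n : ℕ) (f : L2 a b d) : Prop :=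
  ∀ k ≤ n, ∃ g : L2 a b d, IsWeakDeriv a b k f g

open Classical in
/-- The weak derivative `∂^k f ∈ L₂(a,b)^d` (the value `0` if it does not exist in `L₂`). -/
def weakDeriv {d : ℕ} (a b : ℝ) (k : ℕ) (f : L2 a b d) : L2 a b d :=
  if h : ∃ g : L2 a b d, IsWeakDeriv a b k f g then h.choose else 0

open Classical in
/-- The representative of `f ∈ L₂(a,b)^d` that is continuous on `[a, b]` (`0` if there is none);
its values on `[a, b]` are uniquely determined if `a < b`. -/
def continuousRep {d : ℕ} (a b : ℝ) (f : L2 a b d) : ℝ → EuclideanSpace ℝ (Fin d) :=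
  if h : ∃ g : ℝ → EuclideanSpace ℝ (Fin d),
      ContinuousOn g (Icc a b) ∧ f =ᵐ[intervalMeasure a b] g
  then h.choose else 0

/-- The space `ℝ^{nd}`; the coordinate `(i, r)` is the `r`-th entry of the `i`-th block, where
the blocks `i = 0, …, n - 1` have length `d`. -/
abbrev BoundarySpace (n d : ℕ) : Type := EuclideanSpace ℝ (Fin n × Fin d)

/-- The trace `tr_t f = (f(t), f'(t), …, f^(n-1)(t)) ∈ ℝ^{nd}` of `f ∈ H^n(a,b)^d` at
`t ∈ [a, b]`. -/
def trace {d : ℕ} (a b : ℝ) (n : ℕ) (t : ℝ) (f : L2 a b d) : BoundarySpace n d :=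
  WithLp.toLp 2 fun p => continuousRep a b (weakDeriv a b p.1 f) t p.2

/-! ### The port-Hamiltonian operator -/

/-- `𝓗 ∈ L_∞(a,b; ℝ^{d×d})`. -/
def MemLInfty {d : ℕ} (a b : ℝ) (𝓗 : ℝ → Matrix (Fin d) (Fin d) ℝ) : Prop :=
  ∀ i j, MemLp (fun x => 𝓗 x i j) ∞ (intervalMeasure a b)

/-- The pointwise product `𝓗 u`. -/
def mulFun {d : ℕ} (𝓗 : ℝ → Matrix (Fin d) (Fin d) ℝ) (u : ℝ → EuclideanSpace ℝ (Fin d)) :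
    ℝ → EuclideanSpace ℝ (Fin d) :=
  fun x => (𝓗 x).toEuclideanLin (u x)

/-- If `𝓗 ∈ L_∞` and `u ∈ L₂`, then `𝓗 u ∈ L₂`. -/
theorem memLp_mulFun {d : ℕ} {a b : ℝ} {𝓗 : ℝ → Matrix (Fin d) (Fin d) ℝ}
    (h𝓗 : MemLInfty a b 𝓗) (u : L2 a b d) : MemLp (mulFun 𝓗 u) 2 (intervalMeasure a b) := by
  refine MemLp.of_eval_piLp fun i => ?_
  have hu : ∀ j, MemLp (fun x => u x j) 2 (intervalMeasure a b) :=
    fun j => (Lp.memLp u).eval_piLp j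
  have : (fun x => (mulFun 𝓗 u x) i) = fun x => ∑ j, 𝓗 x i j * u x j := by
    funext x
    simp [mulFun, Matrix.mulVec, dotProduct]
  rw [this]
  exact memLp_finsetSum _ fun j _ => (hu j).mul (h𝓗 i j)

/-- The element `𝓗 u` of `L₂(a,b)^d`, for `𝓗 ∈ L_∞` and `u ∈ L₂`. -/
def mulL2 {d : ℕ} {a b : ℝ} {𝓗 : ℝ → Matrix (Fin d) (Fin d) ℝ}
    (h𝓗 : MemLInfty a b 𝓗) (u : L2 a b d) : L2 a b d :=
  (memLp_mulFun h𝓗 u).toLp _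

/-- The inner product `⟨u, v⟩_H = ∫ₐᵇ ⟨𝓗(x) u(x), v(x)⟩ dx`. -/
def weightedInner {d : ℕ} (a b : ℝ) (𝓗 : ℝ → Matrix (Fin d) (Fin d) ℝ) (u v : L2 a b d) : ℝ :=
  ∫ x in Ioo a b, inner ℝ ((𝓗 x).toEuclideanLin (u x)) (v x)

/-- The port-Hamiltonian operator `A u = ∑_{k=0}^n P_k ∂^k (𝓗 u)` with domain
`dom(A) = {u ∈ L₂(a,b)^d ; 𝓗 u ∈ H^n(a,b)^d}`. -/
def portOperator {d : ℕ} {a b : ℝ} (n : ℕ) (P : ℕ → Matrix (Fin d) (Fin d) ℝ)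
    {𝓗 : ℝ → Matrix (Fin d) (Fin d) ℝ} (h𝓗 : MemLInfty a b 𝓗) : L2 a b d →. L2 a b d :=
  fun u => ⟨MemSobolev a b n (mulL2 h𝓗 u), fun _ =>
    ∑ k ∈ Finset.range (n + 1),
      (Matrix.toEuclideanCLM (𝕜 := ℝ) (P k)).compLp (weakDeriv a b k (mulL2 h𝓗 u))⟩

/-! ### The matrices `Q`, `Q₊`, `Q₋` -/

/-- The block matrix `Q ∈ ℝ^{nd×nd}` whose block in row `i` and column `j` (counted from `0`) is
`(-1)^i P_{i+j+1}` if `i + j + 1 ≤ n`, and `0` otherwise. -/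
def boundaryMatrix {d : ℕ} (n : ℕ) (P : ℕ → Matrix (Fin d) (Fin d) ℝ) :
    Matrix (Fin n × Fin d) (Fin n × Fin d) ℝ :=
  fun p q =>
    if (p.1 : ℕ) + q.1 + 1 ≤ n then (-1) ^ (p.1 : ℕ) * P (p.1 + q.1 + 1) p.2 q.2 else 0

open Classical in
/-- The square root of a positive operator: the (unique) positive `S` with `S ∘ S = T`
(`0` if there is none). -/
def positiveSqrt {E : Type*} [NormedAddCommGroup E] [InnerProductSpace ℝ E] (T : E →ₗ[ℝ] E) :
    E →ₗ[ℝ] E :=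
  if h : ∃ S : E →ₗ[ℝ] E, S.IsPositive ∧ S ∘ₗ S = T then h.choose else 0

/-- `E₊`, the linear span of all `x` with `T x = μ x` for some `μ > 0`. -/
def positiveSpace {E : Type*} [NormedAddCommGroup E] [InnerProductSpace ℝ E] (T : E →ₗ[ℝ] E) :
    Submodule ℝ E :=
  Submodule.span ℝ {x | ∃ μ : ℝ, 0 < μ ∧ T x = μ • x}

/-- `ι₊ (ι₊* T ι₊)^{1/2} ι₊*`, where `ι₊` is the embedding of the space `E₊` of `T`. -/
def positiveRoot {E : Type*} [NormedAddCommGroup E] [InnerProductSpace ℝ E]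
    [FiniteDimensional ℝ E] (T : E →ₗ[ℝ] E) : E →ₗ[ℝ] E :=
  let ι : positiveSpace T →ₗ[ℝ] E := (positiveSpace T).subtype
  ι ∘ₗ positiveSqrt (LinearMap.adjoint ι ∘ₗ T ∘ₗ ι) ∘ₗ LinearMap.adjoint ι

/-- `Q₊ = ι₊ (ι₊* Q ι₊)^{1/2} ι₊*` on `ℝ^{nd}`. -/
def Qplus {d : ℕ} (n : ℕ) (P : ℕ → Matrix (Fin d) (Fin d) ℝ) :
    BoundarySpace n d →ₗ[ℝ] BoundarySpace n d :=
  positiveRoot (boundaryMatrix n P).toEuclideanLin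

/-- `Q₋ = ι₋ (ι₋* (-Q) ι₋)^{1/2} ι₋*` on `ℝ^{nd}`; the space `E₋`, spanned by the `x` with
`Q x = μ x` for some `μ < 0`, is the space `E₊` of `-Q`. -/
def Qminus {d : ℕ} (n : ℕ) (P : ℕ → Matrix (Fin d) (Fin d) ℝ) :
    BoundarySpace n d →ₗ[ℝ] BoundarySpace n d :=
  positiveRoot (-(boundaryMatrix n P).toEuclideanLin)

end PortHamiltonian

end

open PortHamiltonian

/-!
The proof separates an abstract part from the analysis of the differential operator.

*Abstract part.* With `y = 𝓗 u`, integration by parts and `P_jᵀ = (-1)^(j+1) P_j` give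
`2 ⟨A u, u⟩_H = ⟨Q tr_b y, tr_b y⟩ - ⟨Q tr_a y, tr_a y⟩`, and since `Q = Q₊² - Q₋²` and
`Q₊ Q₋ = 0`, the right-hand side is `‖F₊ u‖² - ‖F₋ u‖²` for
`F₊ u = Q₊ tr_b y + Q₋ tr_a y` and `F₋ u = Q₋ tr_b y + Q₊ tr_a y`. So a restriction `B` of `A` is
accretive iff `F₋` is a nonexpansive function of `F₊` on `dom B`. On the kernel of `1 + A` the
identity reads `‖F₊ w‖² + 2 ‖w‖² = ‖F₋ w‖²`, so `F₋` is injective there; since the kernel has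
dimension `nd`, it is bijective and `F₊ = C F₋` on the kernel with `‖C‖ < 1`.

* If `dom B` is given by `g (F₊ u) = F₋ u`, solving `u + B u = f` amounts to finding a fixed point
  of a strict contraction `s ↦ g (c + C s)`.
* If `B` is m-accretive, then `F₋ = g F₊` on `dom B` with `g` defined on `S = F₊ (dom B)`. The range
  condition says that `id - C g` maps `S` onto the whole space. Decreasing `C` to `0` in finitely
  many steps, with a contraction argument for each step, one obtains that `id` maps `S` onto the
  whole space, that is, `S = ℝ^{nd}` (`exists_mem_graph_of_shear`); in particular, no extension
  theorem for nonexpansive maps is needed. Maximality of `B` then yields the description of `dom B`.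

This is `isMAccretive_iff_exists_lipschitz`.

*Analysis.* Elements of `H^n(a,b)^d` are described by chains of primitives (`IsSobolevChain`); the
du Bois-Reymond lemma shows that the definition via test functions agrees with this description
(`MemSobolev.exists_isSobolevChain`, `IsSobolevChain.memSobolev`), and that traces and weak
derivatives can be read off from a chain. What the abstract part needs is Green's identity
(`IsSobolevChain.green`), the solvability of `u + A u = f` with arbitrary `tr_a (𝓗 u)`
(`exists_resolvent_solution`, by Picard iteration with bounded measurable coefficients), the
surjectivity of `(tr_a, tr_b)` (`exists_isSobolevChain_trace_eq`), the properties of `Q₊` and `Q₋`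
(`positiveRoot_sq_sub_sq`, `positiveRoot_neg_positiveRoot`) and the invertibility of `Q`
(`boundaryMatrix_injective`).
-/

namespace PortHamiltonian

/-! ### Nonexpansive graphs and m-accretive restrictions -/

theorem exists_fixedPoint_of_norm_sub_le {X : Type*} [NormedAddCommGroup X] [CompleteSpace X]
    {Φ : X → X} {K : ℝ} (hK0 : 0 ≤ K) (hK : K < 1)
    (hΦ : ∀ x y, ‖Φ x - Φ y‖ ≤ K * ‖x - y‖) : ∃ x, Φ x = x := by
  have h : ContractingWith K.toNNReal Φ := by
    refine ⟨by simpa [Real.toNNReal_lt_one] using hK, LipschitzWith.of_dist_le_mul fun x y => ?_⟩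
    rw [dist_eq_norm, dist_eq_norm, Real.coe_toNNReal K hK0]
    exact hΦ x y
  exact ⟨_, h.fixedPoint_isFixedPt⟩

theorem exists_mem_graph_shear_step {X : Type*} [NormedAddCommGroup X] [NormedSpace ℝ X]
    [CompleteSpace X] {Γ : Set (X × X)} (hΓ : ∀ p ∈ Γ, ∀ q ∈ Γ, ‖p.2 - q.2‖ ≤ ‖p.1 - q.1‖)
    {C : X →ₗ[ℝ] X} {K : ℝ} (hK0 : 0 ≤ K) (hK : K < 1) (hC : ∀ x, ‖C x‖ ≤ K * ‖x‖)
    {t ε : ℝ} (ht : |t| ≤ 1) (hε0 : 0 ≤ ε) (hε : ε * K < 1 - K)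
    (h : ∀ c, ∃ p ∈ Γ, p.1 = c + t • C p.2) (c : X) :
    ∃ p ∈ Γ, p.1 = c + (t - ε) • C p.2 := by
  choose p hpΓ hp using h
  have hK1 : 0 < 1 - K := by linarith
  have hlip : ∀ z z', ‖(p z).2 - (p z').2‖ ≤ ‖z - z'‖ / (1 - K) := by
    intro z z'
    have h2 := hΓ _ (hpΓ z) _ (hpΓ z')
    have h1 : ‖(p z).1 - (p z').1‖ ≤ ‖z - z'‖ + K * ‖(p z).2 - (p z').2‖ := by
      have : (p z).1 - (p z').1 = (z - z') + t • C ((p z).2 - (p z').2) := by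
        rw [hp z, hp z', map_sub, smul_sub]; abel
      rw [this]
      refine (norm_add_le _ _).trans ?_
      gcongr
      rw [norm_smul, Real.norm_eq_abs]
      calc |t| * ‖C ((p z).2 - (p z').2)‖ ≤ 1 * ‖C ((p z).2 - (p z').2)‖ := by gcongr
        _ ≤ _ := by rw [one_mul]; exact hC _
    rw [le_div_iff₀ hK1]
    nlinarith [norm_nonneg ((p z).2 - (p z').2)]
  have hL0 : 0 ≤ ε * K / (1 - K) := by positivity
  let Φ : X → X := fun z => c - ε • C (p z).2
  have hΦ : ∀ z z', ‖Φ z - Φ z'‖ ≤ ε * K / (1 - K) * ‖z - z'‖ := by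
    intro z z'
    have : Φ z - Φ z' = - (ε • C ((p z).2 - (p z').2)) := by
      simp only [Φ, map_sub, smul_sub]; abel
    rw [this, norm_neg, norm_smul, Real.norm_eq_abs, abs_of_nonneg hε0]
    calc ε * ‖C ((p z).2 - (p z').2)‖ ≤ ε * (K * (‖z - z'‖ / (1 - K))) := by
          gcongr
          exact (hC _).trans (by gcongr; exact hlip z z')
      _ = _ := by ring
  obtain ⟨z, hfix⟩ := exists_fixedPoint_of_norm_sub_le hL0 ((div_lt_one hK1).2 hε) hΦ
  refine ⟨p z, hpΓ z, ?_⟩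
  calc (p z).1 = z + t • C (p z).2 := hp z
    _ = Φ z + t • C (p z).2 := by rw [hfix]
    _ = _ := by simp only [Φ, sub_smul]; abel

/-- If `(id - C ∘ g)` maps the domain of a nonexpansive partial map `g` (with graph `Γ`) onto the
whole space, where `C` is linear with `‖C‖ < 1`, then `g` is defined everywhere. This is a
continuation argument: the range condition for `t • C` implies the one for `(t - ε) • C`, with a
step size `ε` independent of `t ∈ [0, 1]`. -/
theorem exists_mem_graph_of_shear {X : Type*} [NormedAddCommGroup X] [NormedSpace ℝ X]
    [CompleteSpace X] {Γ : Set (X × X)} (hΓ : ∀ p ∈ Γ, ∀ q ∈ Γ, ‖p.2 - q.2‖ ≤ ‖p.1 - q.1‖)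
    {C : X →ₗ[ℝ] X} {K : ℝ} (hK0 : 0 ≤ K) (hK : K < 1) (hC : ∀ x, ‖C x‖ ≤ K * ‖x‖)
    (h : ∀ c, ∃ p ∈ Γ, p.1 = c + C p.2) (c : X) :
    ∃ p ∈ Γ, p.1 = c := by
  have hK1 : 0 < 1 - K := by linarith
  obtain ⟨N, hN⟩ := exists_nat_gt (K / (1 - K))
  have hN0 : (0 : ℝ) < N := lt_of_le_of_lt (by positivity) hN
  have hε : (1 / N : ℝ) * K < 1 - K := by
    rw [div_lt_iff₀ hK1] at hN
    rw [one_div, inv_mul_lt_iff₀ hN0]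
    exact hN
  have key : ∀ k : ℕ, k ≤ N → ∀ c, ∃ p ∈ Γ, p.1 = c + (1 - k * (1 / N : ℝ)) • C p.2 := by
    intro k
    induction k with
    | zero => intro _ c; simpa using h c
    | succ k ih =>
      intro hk c
      have hkN : (k : ℝ) * (1 / N) ≤ 1 := by
        rw [mul_one_div, div_le_one hN0]
        exact_mod_cast (Nat.le_succ k).trans hk
      have ht : |1 - (k : ℝ) * (1 / N)| ≤ 1 := by
        have : 0 ≤ (k : ℝ) * (1 / N) := by positivity
        rw [abs_le]; constructor <;> linarith
      obtain ⟨p, hp, hpe⟩ := exists_mem_graph_shear_step hΓ hK0 hK hC ht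
        (by positivity) hε (ih ((Nat.le_succ k).trans hk)) c
      refine ⟨p, hp, ?_⟩
      rw [hpe]
      congr 2
      push_cast
      ring
  obtain ⟨p, hp, hpe⟩ := key N le_rfl c
  refine ⟨p, hp, ?_⟩
  rw [hpe, mul_one_div_cancel hN0.ne', sub_self, zero_smul, add_zero]

theorem exists_norm_le_mul_of_norm_lt {X : Type*} [NormedAddCommGroup X] [NormedSpace ℝ X]
    [FiniteDimensional ℝ X] (C : X →ₗ[ℝ] X) (hC : ∀ x, x ≠ 0 → ‖C x‖ < ‖x‖) :
    ∃ K : ℝ, 0 ≤ K ∧ K < 1 ∧ ∀ x, ‖C x‖ ≤ K * ‖x‖ := by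
  rcases subsingleton_or_nontrivial X with hX | hX
  · exact ⟨0, le_rfl, one_pos, fun x => by simp [Subsingleton.elim x 0]⟩
  have : ProperSpace X := FiniteDimensional.proper_real X
  have hcont : ContinuousOn (fun x => ‖C x‖) (Metric.sphere (0 : X) 1) :=
    (LinearMap.continuous_of_finiteDimensional C).norm.continuousOn
  obtain ⟨x₀, hx₀, hmax⟩ := (isCompact_sphere (0 : X) 1).exists_isMaxOn
    (NormedSpace.sphere_nonempty.2 zero_le_one) hcont
  have hx₀' : ‖x₀‖ = 1 := by simpa using hx₀
  refine ⟨‖C x₀‖, norm_nonneg _, ?_, fun x => ?_⟩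
  · rw [← hx₀']
    exact hC _ fun h => by simp [h] at hx₀'
  · rcases eq_or_ne x 0 with rfl | hx
    · simp
    have hn : 0 < ‖x‖ := norm_pos_iff.2 hx
    have hm : ‖C (‖x‖⁻¹ • x)‖ ≤ ‖C x₀‖ :=
      hmax (by simp [norm_smul, hn.ne'])
    rwa [map_smul, norm_smul, norm_inv, norm_norm, inv_mul_le_iff₀ hn, mul_comm] at hm

/-- Let `A` be a linear operator with two boundary maps `Fp`, `Fm` such that
`2 ⟨A w, w⟩ = ‖Fp w‖² - ‖Fm w‖²` and such that `(Fp, Fm)` is onto. If the problem `w + A w = f`,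
`T w = α` is solvable for all data (for one further linear map `T` into the boundary space), then
the m-accretive restrictions of `A` are exactly those given by a boundary condition
`g (Fp w) = Fm w` with a nonexpansive map `g`. -/
theorem isMAccretive_iff_exists_lipschitz {H X : Type*} [AddCommGroup H] [Module ℝ H]
    [NormedAddCommGroup X] [NormedSpace ℝ X] [FiniteDimensional ℝ X] {ip : H → H → ℝ}
    (hneg : ∀ w, ip (-w) w = -ip w w) (hpos : ∀ w, w ≠ 0 → 0 < ip w w)
    {D : Submodule ℝ H} {A : D →ₗ[ℝ] H} {Fp Fm : D →ₗ[ℝ] X} (T : D →ₗ[ℝ] X)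
    (green : ∀ w : D, 2 * ip (A w) w = ‖Fp w‖ ^ 2 - ‖Fm w‖ ^ 2)
    (hsurj : ∀ p q, ∃ w, Fp w = p ∧ Fm w = q)
    (hsolve : ∀ f α, ∃ w : D, (w : H) + A w = f ∧ T w = α)
    (B : H →. H) (hB : ∀ (u : H) (hu : u ∈ B.Dom), ∃ h : u ∈ D, B.fn u hu = A ⟨u, h⟩) :
    IsMAccretive ip B ↔ ∃ g : X → X, LipschitzWith 1 g ∧
      B.Dom = {u | ∃ h : u ∈ D, g (Fp ⟨u, h⟩) = Fm ⟨u, h⟩} := by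
  have : CompleteSpace X := FiniteDimensional.complete ℝ X
  -- `Fm` is an isomorphism from the kernel of `1 + A` onto the boundary space.
  let N : Submodule ℝ D := LinearMap.ker (D.subtype + A)
  have hN : ∀ w : D, w ∈ N ↔ A w = -(w : H) := fun w => by
    rw [LinearMap.mem_ker, LinearMap.add_apply, Submodule.subtype_apply, add_comm,
      add_eq_zero_iff_eq_neg]
  have hNlt : ∀ w ∈ N, w ≠ 0 → ‖Fp w‖ < ‖Fm w‖ := by
    intro w hw hw0
    have h1 := green w
    rw [(hN w).1 hw, hneg] at h1
    have h2 := hpos (w : H) (by simpa using hw0)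
    nlinarith [norm_nonneg (Fp w), norm_nonneg (Fm w)]
  have hinj : Function.Injective (Fm.domRestrict N) := by
    rw [← LinearMap.ker_eq_bot, LinearMap.ker_eq_bot']
    intro w hw
    by_contra hne
    have h1 := hNlt w w.2 (by simpa using hne)
    rw [LinearMap.domRestrict_apply] at hw
    rw [hw, norm_zero] at h1
    exact absurd h1 (not_lt.2 (norm_nonneg _))
  have hTsurj : Function.Surjective (T.domRestrict N) := by
    intro α
    obtain ⟨w, hw, hα⟩ := hsolve 0 α
    exact ⟨⟨w, (hN w).2 (by rw [add_comm] at hw; exact add_eq_zero_iff_eq_neg.1 hw)⟩, hα⟩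
  have : FiniteDimensional ℝ N := FiniteDimensional.of_injective _ hinj
  have hrank : Module.finrank ℝ N = Module.finrank ℝ X :=
    le_antisymm (LinearMap.finrank_le_finrank_of_injective hinj)
      (LinearMap.finrank_le_finrank_of_surjective hTsurj)
  let e : N ≃ₗ[ℝ] X := LinearEquiv.ofBijective _
    ⟨hinj, (LinearMap.injective_iff_surjective_of_finrank_eq_finrank hrank).1 hinj⟩
  have he : ∀ s, Fm (e.symm s : D) = s := fun s => e.apply_symm_apply s
  -- `C` is the map `Fm w ↦ Fp w` on this kernel; it is a strict contraction.
  let C : X →ₗ[ℝ] X := Fp ∘ₗ N.subtype ∘ₗ e.symm.toLinearMap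
  have hCw : ∀ w ∈ N, Fp w = C (Fm w) := by
    intro w hw
    have : e.symm (Fm w) = ⟨w, hw⟩ := by rw [LinearEquiv.symm_apply_eq]; rfl
    simp [C, this]
  obtain ⟨K, hK0, hK1, hCK⟩ := exists_norm_le_mul_of_norm_lt C fun s hs => by
    have h1 := hNlt (e.symm s) (e.symm s).2 (by simpa using hs)
    rwa [he] at h1
  have hacc : ∀ u v (hu : u ∈ D) (hv : v ∈ D), (0 ≤ ip (A ⟨u, hu⟩ - A ⟨v, hv⟩) (u - v) ↔
      ‖Fm ⟨u, hu⟩ - Fm ⟨v, hv⟩‖ ≤ ‖Fp ⟨u, hu⟩ - Fp ⟨v, hv⟩‖) := by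
    intro u v hu hv
    have h1 := green (⟨u, hu⟩ - ⟨v, hv⟩)
    simp only [map_sub, AddSubgroupClass.coe_sub] at h1
    rw [← sq_le_sq₀ (norm_nonneg _) (norm_nonneg _)]
    constructor <;> intro h <;> linarith
  constructor
  · rintro ⟨hBacc, hBran⟩
    let Γ : Set (X × X) := {z | ∃ (u : H) (_ : u ∈ B.Dom) (h : u ∈ D), z = (Fp ⟨u, h⟩, Fm ⟨u, h⟩)}
    have hΓ : ∀ p ∈ Γ, ∀ q ∈ Γ, ‖p.2 - q.2‖ ≤ ‖p.1 - q.1‖ := by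
      rintro _ ⟨u, hu, hu', rfl⟩ _ ⟨v, hv, hv', rfl⟩
      have h1 := hBacc u v hu hv
      obtain ⟨_, hBu⟩ := hB u hu
      obtain ⟨_, hBv⟩ := hB v hv
      rw [hBu, hBv] at h1
      exact (hacc u v hu' hv').1 h1
    have hΓran : ∀ c, ∃ p ∈ Γ, p.1 = c + C p.2 := by
      intro c
      obtain ⟨w, hwp, hwm⟩ := hsurj c 0
      obtain ⟨v, hv, hveq⟩ := hBran ((w : H) + A w)
      obtain ⟨hvD, hBv⟩ := hB v hv
      refine ⟨_, ⟨v, hv, hvD, rfl⟩, ?_⟩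
      have hmem : (⟨v, hvD⟩ : D) - w ∈ N := by
        rw [hN, map_sub, AddSubgroupClass.coe_sub, neg_sub]
        rw [hBv] at hveq
        rw [sub_eq_sub_iff_add_eq_add, add_comm, hveq]
      have h1 := hCw _ hmem
      rw [map_sub, map_sub, hwm, hwp, sub_zero, sub_eq_iff_eq_add'] at h1
      exact h1
    have hall := exists_mem_graph_of_shear hΓ hK0 hK1 hCK hΓran
    choose p hpΓ hp using hall
    refine ⟨fun x => (p x).2, LipschitzWith.of_dist_le_mul fun x y => ?_, ?_⟩
    · rw [dist_eq_norm, dist_eq_norm, NNReal.coe_one, one_mul]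
      simpa only [hp] using hΓ _ (hpΓ x) _ (hpΓ y)
    have hgΓ : ∀ q ∈ Γ, (p q.1).2 = q.2 := by
      intro q hq
      have h1 := hΓ _ (hpΓ q.1) _ hq
      rw [hp, sub_self, norm_zero] at h1
      exact sub_eq_zero.1 (norm_le_zero_iff.1 h1)
    ext u
    constructor
    · intro hu
      obtain ⟨hD, -⟩ := hB u hu
      exact ⟨hD, hgΓ (Fp ⟨u, hD⟩, Fm ⟨u, hD⟩) ⟨u, hu, hD, rfl⟩⟩
    · rintro ⟨hD, hu⟩
      -- `B` has no proper accretive extension: compare `u` with the solution `v` of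
      -- `v + B v = u + A u`.
      obtain ⟨v, hv, hveq⟩ := hBran (u + A ⟨u, hD⟩)
      obtain ⟨hvD, hBv⟩ := hB v hv
      rw [hBv] at hveq
      have h1 : ‖Fm ⟨u, hD⟩ - Fm ⟨v, hvD⟩‖ ≤ ‖Fp ⟨u, hD⟩ - Fp ⟨v, hvD⟩‖ := by
        have h2 := hΓ _ (hpΓ (Fp ⟨u, hD⟩)) _ ⟨v, hv, hvD, rfl⟩
        simp only [hp] at h2
        rwa [← hu]
      rw [← hacc] at h1
      have h3 : A ⟨u, hD⟩ - A ⟨v, hvD⟩ = -(u - v) := by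
        rw [neg_sub, sub_eq_sub_iff_add_eq_add, add_comm, ← hveq]
      rw [h3, hneg] at h1
      by_contra hne
      have : u - v ≠ 0 := fun h => hne (by rwa [sub_eq_zero.1 h])
      linarith [hpos _ this]
  · rintro ⟨g, hg, hdom⟩
    have hg' : ∀ x y, ‖g x - g y‖ ≤ ‖x - y‖ := fun x y => by
      simpa [dist_eq_norm] using hg.dist_le_mul x y
    constructor
    · intro u v hu hv
      obtain ⟨huD, hBu⟩ := hB u hu
      obtain ⟨hvD, hBv⟩ := hB v hv
      rw [hBu, hBv, hacc]
      rw [hdom] at hu hv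
      obtain ⟨_, hu⟩ := hu
      obtain ⟨_, hv⟩ := hv
      rw [← hu, ← hv]
      exact hg' _ _
    · intro f
      obtain ⟨w, hw, -⟩ := hsolve f 0
      -- The solutions of `u + A u = f` are `w + e.symm s`, and the boundary condition becomes a
      -- fixed point equation for a strict contraction.
      let c : X := Fp w - C (Fm w)
      let Φ : X → X := fun s => g (c + C s)
      have hΦ : ∀ s s', ‖Φ s - Φ s'‖ ≤ K * ‖s - s'‖ := by
        intro s s'
        refine (hg' _ _).trans ?_
        rw [add_sub_add_left_eq_sub, ← map_sub]
        exact hCK _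
      obtain ⟨s, hfix⟩ := exists_fixedPoint_of_norm_sub_le hK0 hK1 hΦ
      let z : D := e.symm (s - Fm w)
      have hz : A z = -(z : H) := (hN z).1 (e.symm (s - Fm w)).2
      have hzm : Fm z = s - Fm w := he _
      have hzp : Fp z = C s - C (Fm w) := by
        rw [hCw z (e.symm (s - Fm w)).2, hzm, map_sub]
      have hu : ((w + z : D) : H) ∈ B.Dom := by
        rw [hdom]
        refine ⟨(w + z).2, ?_⟩
        change g (Fp (w + z)) = Fm (w + z)
        rw [map_add, map_add, hzm, hzp, add_sub_cancel]
        convert hfix using 2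
        simp only [c]
        abel
      refine ⟨_, hu, ?_⟩
      obtain ⟨_, hBu⟩ := hB _ hu
      rw [hBu]
      change ((w + z : D) : H) + A (w + z) = f
      rw [map_add, hz, Submodule.coe_add, ← hw]
      abel

/-! ### Primitives of integrable functions -/

/-- `F` is absolutely continuous on `[a, b]` with derivative `f`, expressed by the fundamental
theorem of calculus. -/
structure IsPrimitive {E : Type*} [NormedAddCommGroup E] [NormedSpace ℝ E] (a b : ℝ)
    (F f : ℝ → E) : Prop where
  intervalIntegrable : IntervalIntegrable f volume a b
  eq_add_integral : ∀ t ∈ Icc a b, F t = F a + ∫ x in a..t, f x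

namespace IsPrimitive

variable {E F : Type*} [NormedAddCommGroup E] [NormedSpace ℝ E]
  [NormedAddCommGroup F] [NormedSpace ℝ F] {a b : ℝ}

theorem continuousOn {u v : ℝ → E} (hab : a ≤ b) (h : IsPrimitive a b u v) :
    ContinuousOn u (Icc a b) := by
  have h1 : ContinuousOn (fun t => u a + ∫ x in a..t, v x) (Icc a b) := by
    rw [← uIcc_of_le hab]
    exact continuousOn_const.add (intervalIntegral.continuousOn_primitive_interval
      ((intervalIntegrable_iff' (by finiteness)).1 h.intervalIntegrable))
  exact h1.congr h.eq_add_integral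

theorem mono_right {u v : ℝ → E} (h : IsPrimitive a b u v) {t : ℝ} (ht : t ∈ Icc a b) :
    IntervalIntegrable v volume a t :=
  h.intervalIntegrable.mono_set (by
    rw [uIcc_of_le ht.1, uIcc_of_le (ht.1.trans ht.2)]
    exact Icc_subset_Icc_right ht.2)

theorem clm_comp [CompleteSpace E] [CompleteSpace F] {u v : ℝ → E} (h : IsPrimitive a b u v)
    (L : E →L[ℝ] F) : IsPrimitive a b (fun x => L (u x)) (fun x => L (v x)) := by
  refine ⟨⟨L.integrable_comp h.1.1, L.integrable_comp h.1.2⟩, fun t ht => ?_⟩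
  rw [L.intervalIntegral_comp_comm (h.mono_right ht), ← map_add, ← h.eq_add_integral t ht]

theorem add {u v u' v' : ℝ → E} (h : IsPrimitive a b u v) (h' : IsPrimitive a b u' v') :
    IsPrimitive a b (u + u') (v + v') := by
  refine ⟨h.1.add h'.1, fun t ht => ?_⟩
  simp only [Pi.add_apply]
  rw [intervalIntegral.integral_add (h.mono_right ht) (h'.mono_right ht),
    h.eq_add_integral t ht, h'.eq_add_integral t ht]
  abel

theorem const_smul {u v : ℝ → E} (h : IsPrimitive a b u v) (c : ℝ) :
    IsPrimitive a b (c • u) (c • v) := by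
  refine ⟨h.1.smul c, fun t ht => ?_⟩
  simp only [Pi.smul_apply]
  rw [intervalIntegral.integral_smul, ← smul_add, ← h.eq_add_integral t ht]

theorem of_hasDerivAt [CompleteSpace E] {u v : ℝ → E} (hu : ∀ t, HasDerivAt u (v t) t)
    (hv : Continuous v) : IsPrimitive a b u v := by
  refine ⟨hv.intervalIntegrable _ _, fun t _ => ?_⟩
  rw [intervalIntegral.integral_eq_sub_of_hasDerivAt (fun x _ => hu x)
    (hv.intervalIntegrable _ _), add_sub_cancel]

theorem integral_mul_add_mul {u v u' v' : ℝ → ℝ} (hab : a ≤ b) (h : IsPrimitive a b u v)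
    (h' : IsPrimitive a b u' v') :
    ∫ x in a..b, (v x * u' x + u x * v' x) = u b * u' b - u a * u' a := by
  have key : ∀ {u v : ℝ → ℝ}, IsPrimitive a b u v →
      AbsolutelyContinuousOnInterval (fun t => u a + ∫ x in a..t, v x) a b ∧
      ∀ᵐ x, x ∈ uIcc a b → HasDerivAt (fun t => u a + ∫ x in a..t, v x) (v x) x := by
    intro u v h
    refine ⟨?_, ?_⟩
    · have h1 : AbsolutelyContinuousOnInterval (fun _ : ℝ => u a) a b :=
        contDiffOn_const.absolutelyContinuousOnInterval
      exact h1.fun_add (h.1.absolutelyContinuousOnInterval_intervalIntegral left_mem_uIcc)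
    · filter_upwards [h.1.ae_hasDerivAt_integral] with x hx hxm
      exact (hx hxm a left_mem_uIcc).const_add _
  obtain ⟨hac, hd⟩ := key h
  obtain ⟨hac', hd'⟩ := key h'
  have hmem : ∀ x ∈ uIcc a b, x ∈ Icc a b := fun x hx => by rwa [uIcc_of_le hab] at hx
  rw [h.eq_add_integral b (right_mem_Icc.2 hab), h'.eq_add_integral b (right_mem_Icc.2 hab)]
  have h1 := hac.integral_deriv_mul_eq_sub hac'
  simp only [intervalIntegral.integral_same, add_zero] at h1
  rw [← h1]
  refine intervalIntegral.integral_congr_ae ?_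
  filter_upwards [hd, hd'] with x hx hx' hxm
  have hxm' := uIoc_subset_uIcc hxm
  rw [(hx hxm').deriv, (hx' hxm').deriv, ← h.eq_add_integral x (hmem x hxm'),
    ← h'.eq_add_integral x (hmem x hxm')]

section Euclidean

variable {ι : Type*} [Fintype ι]

theorem eval {u v : ℝ → EuclideanSpace ℝ ι} (h : IsPrimitive a b u v) (i : ι) :
    IsPrimitive a b (fun x => u x i) (fun x => v x i) :=
  h.clm_comp (EuclideanSpace.proj i)

theorem intervalIntegrable_mul_add_mul {u v u' v' : ℝ → ℝ} (hab : a ≤ b)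
    (h : IsPrimitive a b u v) (h' : IsPrimitive a b u' v') :
    IntervalIntegrable (fun x => v x * u' x + u x * v' x) volume a b := by
  refine (h.1.mul_continuousOn ?_).add (h'.1.continuousOn_mul ?_)
  · rw [uIcc_of_le hab]; exact h'.continuousOn hab
  · rw [uIcc_of_le hab]; exact h.continuousOn hab

/-- The product rule for the inner product of absolutely continuous functions. -/
theorem integral_inner_add_inner {u v u' v' : ℝ → EuclideanSpace ℝ ι} (hab : a ≤ b)
    (h : IsPrimitive a b u v) (h' : IsPrimitive a b u' v') :
    ∫ x in a..b, (inner ℝ (v x) (u' x) + inner ℝ (u x) (v' x)) =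
      inner ℝ (u b) (u' b) - inner ℝ (u a) (u' a) := by
  have h1 : ∀ x, inner ℝ (v x) (u' x) + inner ℝ (u x) (v' x) =
      ∑ i, (v x i * u' x i + u x i * v' x i) := by
    intro x
    simp only [PiLp.inner_apply, RCLike.inner_apply, conj_trivial, ← Finset.sum_add_distrib]
    exact Finset.sum_congr rfl fun i _ => by ring
  simp only [h1]
  rw [intervalIntegral.integral_finsetSum fun i _ =>
    (h.eval i).intervalIntegrable_mul_add_mul hab (h'.eval i)]
  rw [Finset.sum_congr rfl fun i _ => (h.eval i).integral_mul_add_mul hab (h'.eval i),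
    Finset.sum_sub_distrib]
  simp only [PiLp.inner_apply, RCLike.inner_apply, conj_trivial]
  congr 1 <;> exact Finset.sum_congr rfl fun i _ => by ring

theorem integral_smul_add_smul {φ φ' : ℝ → ℝ} {u v : ℝ → EuclideanSpace ℝ ι} (hab : a ≤ b)
    (hφ : IsPrimitive a b φ φ') (h : IsPrimitive a b u v) :
    (∫ x in a..b, φ' x • u x) + ∫ x in a..b, φ x • v x = φ b • u b - φ a • u a := by
  have hi1 : IntervalIntegrable (fun x => φ' x • u x) volume a b :=
    hφ.1.smul_continuousOn (by rw [uIcc_of_le hab]; exact h.continuousOn hab)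
  have hi2 : IntervalIntegrable (fun x => φ x • v x) volume a b :=
    h.1.continuousOn_smul (by rw [uIcc_of_le hab]; exact hφ.continuousOn hab)
  rw [← intervalIntegral.integral_add hi1 hi2]
  ext i
  have h1 := (EuclideanSpace.proj (𝕜 := ℝ) i).intervalIntegral_comp_comm (hi1.add hi2)
  simp only [PiLp.proj_apply] at h1
  rw [← h1]
  simpa using hφ.integral_mul_add_mul hab (h.eval i)

end Euclidean

end IsPrimitive

/-! ### Test functions and the du Bois-Reymond lemma -/

/-- Test functions on `(a, b)`, the elements of `C_c^∞(a, b)`. -/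
structure IsTestFunction (a b : ℝ) (φ : ℝ → ℝ) : Prop where
  contDiff : ContDiff ℝ ∞ φ
  hasCompactSupport : HasCompactSupport φ
  tsupport_subset : tsupport φ ⊆ Ioo a b

namespace IsTestFunction

variable {a b : ℝ} {φ : ℝ → ℝ}

theorem deriv (h : IsTestFunction a b φ) : IsTestFunction a b (deriv φ) :=
  ⟨(contDiff_infty_iff_deriv.1 h.1).2, h.2.deriv, tsupport_deriv_subset.trans h.3⟩

theorem eq_zero (h : IsTestFunction a b φ) {x : ℝ} (hx : x ∉ Ioo a b) : φ x = 0 :=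
  image_eq_zero_of_notMem_tsupport fun h' => hx (h.3 h')

theorem isPrimitive (h : IsTestFunction a b φ) : IsPrimitive a b φ (_root_.deriv φ) :=
  IsPrimitive.of_hasDerivAt
    (fun t => ((h.1.differentiable (by simp)) t).hasDerivAt) h.deriv.1.continuous

theorem integrable_smul {E : Type*} [NormedAddCommGroup E] [NormedSpace ℝ E] {u : ℝ → E}
    (h : IsTestFunction a b φ) (hu : IntegrableOn u (Ioo a b)) :
    Integrable (fun x => φ x • u x) (intervalMeasure a b) := by
  obtain ⟨C, hC⟩ := h.2.exists_bound_of_continuous h.1.continuous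
  exact hu.bdd_smul C h.1.continuous.aestronglyMeasurable (Filter.Eventually.of_forall hC)

theorem sub_const_mul {ψ : ℝ → ℝ} (h : IsTestFunction a b φ) (h' : IsTestFunction a b ψ) (c : ℝ) :
    IsTestFunction a b (fun x => φ x - c * ψ x) := by
  have hs : tsupport (fun x => φ x - c * ψ x) ⊆ tsupport φ ∪ tsupport ψ := by
    refine closure_minimal ?_ ((isClosed_tsupport _).union (isClosed_tsupport _))
    intro x hx
    by_contra hx'
    rw [mem_union, not_or] at hx'
    exact hx (by
      simp [image_eq_zero_of_notMem_tsupport hx'.1, image_eq_zero_of_notMem_tsupport hx'.2])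
  refine ⟨h.1.sub (contDiff_const.mul h'.1), ?_, hs.trans (union_subset h.3 h'.3)⟩
  exact (h.2.isCompact.union h'.2.isCompact).of_isClosed_subset (isClosed_tsupport _) hs

/-- A test function of integral zero is the derivative of a test function. -/
theorem exists_deriv_eq (h : IsTestFunction a b φ) (hab : a < b) (h0 : ∫ x in a..b, φ x = 0) :
    ∃ ψ, IsTestFunction a b ψ ∧ _root_.deriv ψ = φ := by
  obtain ⟨a', b', ha, hb, hsub⟩ : ∃ a' b', a < a' ∧ b' < b ∧ tsupport φ ⊆ Icc a' b' := by
    rcases (tsupport φ).eq_empty_or_nonempty with he | hne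
    · obtain ⟨m, h1, h2⟩ := exists_between hab
      exact ⟨m, m, h1, h2, by simp [he]⟩
    · obtain ⟨a', ha', hl⟩ := h.2.isCompact.exists_isLeast hne
      obtain ⟨b', hb', hg⟩ := h.2.isCompact.exists_isGreatest hne
      exact ⟨a', b', (h.3 ha').1, (h.3 hb').2, fun x hx => ⟨hl hx, hg hx⟩⟩
  have hzero : ∀ x, x ∉ Icc a' b' → φ x = 0 := fun x hx =>
    image_eq_zero_of_notMem_tsupport fun hx' => hx (hsub hx')
  have hderiv : ∀ t, HasDerivAt (fun t => ∫ x in a..t, φ x) (φ t) t := fun t =>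
    (h.1.continuous.integral_hasStrictDerivAt a t).hasDerivAt
  have hd : _root_.deriv (fun t => ∫ x in a..t, φ x) = φ := funext fun t => (hderiv t).deriv
  have hs : tsupport (fun t => ∫ x in a..t, φ x) ⊆ Icc a' b' := by
    refine closure_minimal ?_ isClosed_Icc
    intro t ht
    by_contra ht'
    refine ht ?_
    rw [mem_Icc, not_and_or, not_le, not_le] at ht'
    rcases ht' with ht' | ht'
    · have : ∀ x ∈ uIcc a t, φ x = 0 := fun x hx => hzero x fun hx' => by
        have := hx.2.trans_lt (max_lt ha ht')
        exact absurd hx'.1 (not_le.2 this)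
      exact (intervalIntegral.integral_congr this).trans intervalIntegral.integral_zero
    · have : ∀ x ∈ uIcc b t, φ x = 0 := fun x hx => hzero x fun hx' => by
        have := (lt_min hb ht').trans_le hx.1
        exact absurd hx'.2 (not_le.2 this)
      have h2 : ∫ x in b..t, φ x = 0 :=
        (intervalIntegral.integral_congr this).trans intervalIntegral.integral_zero
      change ∫ x in a..t, φ x = 0
      rw [← intervalIntegral.integral_add_adjacent_intervals
        (h.1.continuous.intervalIntegrable a b) (h.1.continuous.intervalIntegrable b t), h0, h2,
        add_zero]
  refine ⟨_, ⟨contDiff_infty_iff_deriv.2 ⟨fun t => (hderiv t).differentiableAt, ?_⟩, ?_, ?_⟩, hd⟩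
  · rw [hd]; exact h.1
  · exact isCompact_Icc.of_isClosed_subset (isClosed_tsupport _) hs
  · exact hs.trans fun x hx => ⟨ha.trans_le hx.1, hx.2.trans_lt hb⟩

end IsTestFunction

theorem exists_isTestFunction_integral_eq_one {a b : ℝ} (hab : a < b) :
    ∃ ρ, IsTestFunction a b ρ ∧ ∫ x in a..b, ρ x = 1 := by
  let f : ContDiffBump ((a + b) / 2) :=
    ⟨(b - a) / 8, (b - a) / 4, by linarith, by linarith⟩
  have hsub : tsupport (f.normed volume) ⊆ Ioo a b := by
    rw [f.tsupport_normed_eq, Real.closedBall_eq_Icc]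
    intro x hx
    have h1 : f.rOut = (b - a) / 4 := rfl
    rw [h1] at hx
    exact ⟨by linarith [hx.1], by linarith [hx.2]⟩
  refine ⟨f.normed volume, ⟨f.contDiff_normed, f.hasCompactSupport_normed, hsub⟩, ?_⟩
  rw [← f.integral_normed (μ := volume)]
  refine intervalIntegral.integral_eq_integral_of_support_subset ?_
  exact (subset_tsupport _).trans (hsub.trans Ioo_subset_Ioc_self)

theorem integral_Ioo_eq_intervalIntegral {E : Type*} [NormedAddCommGroup E] [NormedSpace ℝ E]
    {a b : ℝ} (hab : a ≤ b) (f : ℝ → E) : ∫ x in Ioo a b, f x = ∫ x in a..b, f x := by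
  rw [intervalIntegral.integral_of_le hab, integral_Ioc_eq_integral_Ioo]

section DuBoisReymond

variable {ι : Type*} [Fintype ι] {a b : ℝ}

theorem ae_eq_zero_of_forall_isTestFunction {w : ℝ → EuclideanSpace ℝ ι}
    (hw : IntegrableOn w (Ioo a b))
    (h : ∀ φ, IsTestFunction a b φ → ∫ x in Ioo a b, φ x • w x = 0) :
    w =ᵐ[intervalMeasure a b] 0 := by
  have h1 := IsOpen.ae_eq_zero_of_integral_contDiff_smul_eq_zero (μ := intervalMeasure a b)
    isOpen_Ioo ((Integrable.locallyIntegrable hw).locallyIntegrableOn _)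
    (fun φ h1 h2 h3 => h φ ⟨h1, h2, h3⟩)
  filter_upwards [h1, ae_restrict_mem measurableSet_Ioo] with x hx hxm
  exact hx hxm

/-- An integrable function with weak derivative zero is constant. -/
theorem exists_ae_eq_const_of_forall_isTestFunction {w : ℝ → EuclideanSpace ℝ ι} (hab : a < b)
    (hw : IntegrableOn w (Ioo a b))
    (h : ∀ φ, IsTestFunction a b φ → ∫ x in Ioo a b, deriv φ x • w x = 0) :
    ∃ c, w =ᵐ[intervalMeasure a b] fun _ => c := by
  obtain ⟨ρ, hρ, hρ1⟩ := exists_isTestFunction_integral_eq_one hab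
  set c := ∫ x in Ioo a b, ρ x • w x with hc
  refine ⟨c, ?_⟩
  have hci : IntegrableOn (fun _ : ℝ => c) (Ioo a b) := integrableOn_const (by simp)
  have h0 := ae_eq_zero_of_forall_isTestFunction (hw.sub hci) fun φ hφ => ?_
  · filter_upwards [h0] with x hx
    exact sub_eq_zero.1 hx
  set m := ∫ x in a..b, φ x with hm
  -- `φ - m ρ` has integral zero, so it is the derivative of a test function.
  obtain ⟨ψ, hψ, hψd⟩ := (hφ.sub_const_mul hρ m).exists_deriv_eq hab (by
    rw [intervalIntegral.integral_sub (hφ.1.continuous.intervalIntegrable _ _)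
      ((hρ.1.continuous.intervalIntegrable _ _).const_mul m),
      intervalIntegral.integral_const_mul, hρ1, mul_one, sub_self])
  have h1 := h ψ hψ
  rw [hψd] at h1
  simp only [sub_smul, mul_smul] at h1
  rw [integral_sub (hφ.integrable_smul hw) (Integrable.fun_smul m (hρ.integrable_smul hw)),
    integral_smul, sub_eq_zero] at h1
  simp only [Pi.sub_apply, smul_sub]
  rw [integral_sub (hφ.integrable_smul hw) (hφ.integrable_smul hci), h1, integral_smul_const,
    integral_Ioo_eq_intervalIntegral hab.le φ, sub_self]

theorem integral_deriv_smul_eq_neg {u v : ℝ → EuclideanSpace ℝ ι} (hab : a ≤ b)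
    (h : IsPrimitive a b u v) {φ : ℝ → ℝ} (hφ : IsTestFunction a b φ) :
    ∫ x in Ioo a b, deriv φ x • u x = -∫ x in Ioo a b, φ x • v x := by
  rw [integral_Ioo_eq_intervalIntegral hab, integral_Ioo_eq_intervalIntegral hab,
    eq_neg_iff_add_eq_zero, hφ.isPrimitive.integral_smul_add_smul hab h,
    hφ.eq_zero (x := b) (by simp), hφ.eq_zero (x := a) (by simp)]
  simp

/-- If `v` is the weak derivative of `u`, then `u` agrees almost everywhere with a primitive of
`v`. -/
theorem exists_isPrimitive_of_weak {u v : ℝ → EuclideanSpace ℝ ι} (hab : a < b)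
    (hu : IntegrableOn u (Ioo a b)) (hv : IntegrableOn v (Ioo a b))
    (h : ∀ φ, IsTestFunction a b φ →
      ∫ x in Ioo a b, deriv φ x • u x = -∫ x in Ioo a b, φ x • v x) :
    ∃ U, IsPrimitive a b U v ∧ u =ᵐ[intervalMeasure a b] U := by
  have hv' := (intervalIntegrable_iff_integrableOn_Ioo_of_le hab.le).2 hv
  have hprim : ∀ c, IsPrimitive a b (fun t => c + ∫ x in a..t, v x) v := fun c =>
    ⟨hv', fun t _ => by simp⟩
  have hint : IntegrableOn (fun t => ∫ x in a..t, v x) (Ioo a b) := by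
    have := (hprim 0).continuousOn hab.le
    simp only [zero_add] at this
    exact (this.integrableOn_compact isCompact_Icc).mono_set Ioo_subset_Icc_self
  obtain ⟨c, hc⟩ := exists_ae_eq_const_of_forall_isTestFunction hab (hu.sub hint) fun φ hφ => by
    have h1 := integral_deriv_smul_eq_neg hab.le (hprim 0) hφ
    simp only [zero_add] at h1
    simp only [Pi.sub_apply, smul_sub]
    rw [integral_sub (hφ.deriv.integrable_smul hu) (hφ.deriv.integrable_smul hint), h φ hφ, h1,
      sub_self]
  refine ⟨_, hprim c, ?_⟩
  filter_upwards [hc] with x hx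
  rw [← hx]
  simp

end DuBoisReymond

/-! ### Sobolev functions as chains of primitives -/

section SobolevChain

variable {a b : ℝ} {n d : ℕ}

/-- A function of class `H^n` on `(a, b)` together with its derivatives: `Y 0, …, Y n` are in
`L₂` and each `Y k` with `k < n` is the continuous representative, with derivative `Y (k + 1)`. -/
structure IsSobolevChain (a b : ℝ) (n : ℕ) (Y : ℕ → ℝ → EuclideanSpace ℝ (Fin d)) : Prop where
  isPrimitive : ∀ k < n, IsPrimitive a b (Y k) (Y (k + 1))
  memLp : ∀ k ≤ n, MemLp (Y k) 2 (intervalMeasure a b)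

theorem memLp_of_continuousOn {E : Type*} [NormedAddCommGroup E] {u : ℝ → E}
    (h : ContinuousOn u (Icc a b)) : MemLp u 2 (intervalMeasure a b) := by
  obtain ⟨C, hC⟩ := isCompact_Icc.exists_bound_of_continuousOn h
  refine MemLp.of_bound ((h.mono Ioo_subset_Icc_self).aestronglyMeasurable measurableSet_Ioo) C ?_
  filter_upwards [ae_restrict_mem measurableSet_Ioo] with x hx
  exact hC x (Ioo_subset_Icc_self hx)

theorem eqOn_of_continuousOn_of_ae_eq {E : Type*} [NormedAddCommGroup E] {u v : ℝ → E}
    (hab : a < b) (hu : ContinuousOn u (Icc a b)) (hv : ContinuousOn v (Icc a b))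
    (h : u =ᵐ[intervalMeasure a b] v) : EqOn u v (Icc a b) := by
  refine Measure.eqOn_Icc_of_ae_eq (μ := volume) hab.ne ?_ hu hv
  rwa [← Measure.restrict_congr_set Ioo_ae_eq_Icc]

theorem continuousRep_eqOn {f : L2 a b d} {g : ℝ → EuclideanSpace ℝ (Fin d)} (hab : a < b)
    (hg : ContinuousOn g (Icc a b)) (hfg : f =ᵐ[intervalMeasure a b] g) :
    EqOn (continuousRep a b f) g (Icc a b) := by
  have h : ∃ g : ℝ → EuclideanSpace ℝ (Fin d),
      ContinuousOn g (Icc a b) ∧ f =ᵐ[intervalMeasure a b] g := ⟨g, hg, hfg⟩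
  rw [continuousRep, dif_pos h]
  exact eqOn_of_continuousOn_of_ae_eq hab h.choose_spec.1 hg (h.choose_spec.2.symm.trans hfg)

theorem integrableOn_of_memLp {u : ℝ → EuclideanSpace ℝ (Fin d)}
    (h : MemLp u 2 (intervalMeasure a b)) : IntegrableOn u (Ioo a b) :=
  h.integrable (by norm_num)

theorem IsWeakDeriv.ae_eq {k : ℕ} {f g g' : ℝ → EuclideanSpace ℝ (Fin d)}
    (hg : IntegrableOn g (Ioo a b)) (hg' : IntegrableOn g' (Ioo a b))
    (h : IsWeakDeriv a b k f g) (h' : IsWeakDeriv a b k f g') : g =ᵐ[intervalMeasure a b] g' := by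
  have h0 := ae_eq_zero_of_forall_isTestFunction (hg.sub hg') fun φ hφ => by
    have h1 := (h φ hφ.1 hφ.2 hφ.3).symm.trans (h' φ hφ.1 hφ.2 hφ.3)
    have h2 := smul_right_injective _ (pow_ne_zero k (by norm_num : (-1 : ℝ) ≠ 0)) h1
    simp only [Pi.sub_apply, smul_sub]
    rw [integral_sub (hφ.integrable_smul hg) (hφ.integrable_smul hg'), sub_eq_zero]
    exact h2
  filter_upwards [h0] with x hx
  exact sub_eq_zero.1 hx

theorem IsWeakDeriv.congr_right {k : ℕ} {f g g' : ℝ → EuclideanSpace ℝ (Fin d)}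
    (h : IsWeakDeriv a b k f g) (hg : g =ᵐ[intervalMeasure a b] g') : IsWeakDeriv a b k f g' := by
  intro φ h1 h2 h3
  rw [h φ h1 h2 h3]
  congr 1
  exact integral_congr_ae (hg.mono fun x hx => by simp only [hx])

theorem weakDeriv_ae_eq {k : ℕ} {f : L2 a b d} {g : ℝ → EuclideanSpace ℝ (Fin d)}
    (hg : MemLp g 2 (intervalMeasure a b)) (h : IsWeakDeriv a b k f g) :
    weakDeriv a b k f =ᵐ[intervalMeasure a b] g := by
  have hex : ∃ g : L2 a b d, IsWeakDeriv a b k f g :=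
    ⟨hg.toLp g, h.congr_right hg.coeFn_toLp.symm⟩
  rw [weakDeriv, dif_pos hex]
  exact IsWeakDeriv.ae_eq (integrableOn_of_memLp (Lp.memLp _)) (integrableOn_of_memLp hg)
    hex.choose_spec h

namespace IsSobolevChain

variable {Y Z : ℕ → ℝ → EuclideanSpace ℝ (Fin d)}

theorem of_isPrimitive (hab : a ≤ b) (h : ∀ k < n, IsPrimitive a b (Y k) (Y (k + 1)))
    (hn : MemLp (Y n) 2 (intervalMeasure a b)) : IsSobolevChain a b n Y := by
  refine ⟨h, fun k hk => ?_⟩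
  rcases hk.lt_or_eq with hk | rfl
  · exact memLp_of_continuousOn ((h k hk).continuousOn hab)
  · exact hn

theorem add (hY : IsSobolevChain a b n Y) (hZ : IsSobolevChain a b n Z) :
    IsSobolevChain a b n (fun k => Y k + Z k) :=
  ⟨fun k hk => (hY.1 k hk).add (hZ.1 k hk), fun k hk => (hY.2 k hk).add (hZ.2 k hk)⟩

theorem const_smul (hY : IsSobolevChain a b n Y) (c : ℝ) :
    IsSobolevChain a b n (fun k => c • Y k) :=
  ⟨fun k hk => (hY.1 k hk).const_smul c, fun k hk => (hY.2 k hk).const_smul c⟩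

theorem continuousOn (hY : IsSobolevChain a b n Y) (hab : a ≤ b) {k : ℕ} (hk : k < n) :
    ContinuousOn (Y k) (Icc a b) :=
  (hY.1 k hk).continuousOn hab

theorem integral_iteratedDeriv_smul (hY : IsSobolevChain a b n Y) (hab : a ≤ b) {k : ℕ}
    (hk : k ≤ n) {φ : ℝ → ℝ} (hφ : IsTestFunction a b φ) :
    ∫ x in Ioo a b, iteratedDeriv k φ x • Y 0 x = (-1 : ℝ) ^ k • ∫ x in Ioo a b, φ x • Y k x := by
  induction k generalizing φ with
  | zero => simp
  | succ k ih =>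
    rw [iteratedDeriv_succ', ih (Nat.le_of_succ_le hk) hφ.deriv,
      integral_deriv_smul_eq_neg hab (hY.1 k hk) hφ, pow_succ, smul_neg, mul_neg_one, neg_smul]

variable {y z : L2 a b d}

theorem isWeakDeriv (hY : IsSobolevChain a b n Y) (hab : a ≤ b)
    (hy : y =ᵐ[intervalMeasure a b] Y 0) {k : ℕ} (hk : k ≤ n) : IsWeakDeriv a b k y (Y k) := by
  intro φ h1 h2 h3
  rw [← hY.integral_iteratedDeriv_smul hab hk ⟨h1, h2, h3⟩]
  exact integral_congr_ae (hy.mono fun x hx => by simp only [hx])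

theorem memSobolev (hY : IsSobolevChain a b n Y) (hab : a ≤ b)
    (hy : y =ᵐ[intervalMeasure a b] Y 0) : MemSobolev a b n y := fun k hk =>
  ⟨(hY.2 k hk).toLp _, (hY.isWeakDeriv hab hy hk).congr_right (hY.2 k hk).coeFn_toLp.symm⟩

theorem weakDeriv_ae_eq (hY : IsSobolevChain a b n Y) (hab : a ≤ b)
    (hy : y =ᵐ[intervalMeasure a b] Y 0) {k : ℕ} (hk : k ≤ n) :
    weakDeriv a b k y =ᵐ[intervalMeasure a b] Y k :=
  PortHamiltonian.weakDeriv_ae_eq (hY.2 k hk) (hY.isWeakDeriv hab hy hk)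

theorem trace_eq (hY : IsSobolevChain a b n Y) (hab : a < b)
    (hy : y =ᵐ[intervalMeasure a b] Y 0) {t : ℝ} (ht : t ∈ Icc a b) :
    trace a b n t y = WithLp.toLp 2 fun p => Y p.1 t p.2 := by
  unfold trace
  congr 1
  funext p
  rw [continuousRep_eqOn hab (hY.continuousOn hab.le p.1.2)
    (hY.weakDeriv_ae_eq hab.le hy p.1.2.le) ht]

end IsSobolevChain

theorem MemSobolev.exists_isSobolevChain {y : L2 a b d} (hab : a < b) (hy : MemSobolev a b n y) :
    ∃ Y, IsSobolevChain a b n Y ∧ y =ᵐ[intervalMeasure a b] Y 0 := by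
  choose! g hg using hy
  have hint : ∀ k, IntegrableOn (g k) (Ioo a b) := fun k => integrableOn_of_memLp (Lp.memLp _)
  have hstep : ∀ k < n, ∃ U, IsPrimitive a b U (g (k + 1)) ∧ g k =ᵐ[intervalMeasure a b] U := by
    intro k hk
    refine exists_isPrimitive_of_weak hab (hint k) (hint (k + 1)) fun φ hφ => ?_
    have h1 := hg k hk.le _ hφ.deriv.1 hφ.deriv.2 hφ.deriv.3
    have h2 := hg (k + 1) hk φ hφ.1 hφ.2 hφ.3
    rw [iteratedDeriv_succ', h1, pow_succ, mul_neg_one, neg_smul, ← smul_neg] at h2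
    exact smul_right_injective _ (pow_ne_zero k (by norm_num : (-1 : ℝ) ≠ 0)) h2
  choose! U hU hgU using hstep
  let Y : ℕ → ℝ → EuclideanSpace ℝ (Fin d) := fun k => if k < n then U k else g k
  have hYg : ∀ k ≤ n, g k =ᵐ[intervalMeasure a b] Y k := by
    intro k hk
    by_cases h : k < n
    · simp only [Y, if_pos h]; exact hgU k h
    · simp only [Y, if_neg h]; rfl
  have hy0 : y =ᵐ[intervalMeasure a b] g 0 := by
    refine IsWeakDeriv.ae_eq (k := 0) (f := y) (integrableOn_of_memLp (Lp.memLp _)) (hint 0) ?_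
      (hg 0 n.zero_le)
    intro φ _ _ _
    simp
  refine ⟨Y, IsSobolevChain.of_isPrimitive hab.le (fun k hk => ?_) ?_, hy0.trans (hYg 0 n.zero_le)⟩
  · have hc := (hYg (k + 1) hk)
    have h1 : Y k = U k := by simp only [Y, if_pos hk]
    rw [h1]
    refine ⟨?_, fun t ht => ?_⟩
    · rw [intervalIntegrable_iff_integrableOn_Ioo_of_le hab.le]
      exact (hint (k + 1)).congr hc
    · rw [(hU k hk).eq_add_integral t ht]
      congr 1
      rw [← integral_Ioo_eq_intervalIntegral ht.1, ← integral_Ioo_eq_intervalIntegral ht.1]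
      exact integral_congr_ae
        (ae_mono (Measure.restrict_mono (Ioo_subset_Ioo_right ht.2) le_rfl) hc)
  · exact (memLp_congr_ae (hYg n le_rfl)).1 (Lp.memLp _)

end SobolevChain

/-! ### Linear differential equations with bounded measurable coefficients -/

/-- Picard's theorem for right-hand sides that are Lipschitz in the second variable, uniformly in
almost every value of the first, and only integrable along continuous curves. -/
theorem exists_continuous_eq_add_integral {E : Type*} [NormedAddCommGroup E] [NormedSpace ℝ E]
    [CompleteSpace E] {a b : ℝ} (hab : a ≤ b) {Φ : ℝ → E → E} {K : ℝ} (hK : 0 ≤ K)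
    (hΦ : ∀ᵐ x ∂(intervalMeasure a b), ∀ v w, ‖Φ x v - Φ x w‖ ≤ K * ‖v - w‖)
    (hint : ∀ u : ℝ → E, Continuous u → IntervalIntegrable (fun x => Φ x (u x)) volume a b)
    (y₀ : E) :
    ∃ u : ℝ → E, Continuous u ∧ ∀ t ∈ Icc a b, u t = y₀ + ∫ x in a..t, Φ x (u x) := by
  have hΦ' : ∀ᵐ x, x ∈ Ioc a b → ∀ v w, ‖Φ x v - Φ x w‖ ≤ K * ‖v - w‖ := by
    rw [← ae_restrict_iff' measurableSet_Ioc, ← Measure.restrict_congr_set Ioo_ae_eq_Ioc]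
    exact hΦ
  let ext : C(Icc a b, E) → ℝ → E := fun u => IccExtend hab u
  have hext : ∀ u, Continuous (ext u) := fun u => u.continuous.Icc_extend'
  have hint' : ∀ u, ∀ t ∈ Icc a b, IntervalIntegrable (fun x => Φ x (ext u x)) volume a t := by
    intro u t ht
    refine (hint _ (hext u)).mono_set ?_
    rw [uIcc_of_le ht.1, uIcc_of_le hab]
    exact Icc_subset_Icc_right ht.2
  let T : C(Icc a b, E) → C(Icc a b, E) := fun u =>
    ⟨fun t => y₀ + ∫ x in a..t, Φ x (ext u x), by
      have h1 : ContinuousOn (fun t => y₀ + ∫ x in a..t, Φ x (ext u x)) (Icc a b) := by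
        rw [← uIcc_of_le hab]
        exact continuousOn_const.add (intervalIntegral.continuousOn_primitive_interval
          ((intervalIntegrable_iff' (by finiteness)).1 (hint _ (hext u))))
      exact continuousOn_iff_continuous_domRestrict.1 h1⟩
  have hT : ∀ u t, T u t = y₀ + ∫ x in a..t, Φ x (ext u x) := fun _ _ => rfl
  have hpow : ∀ (k : ℕ) (t : ℝ), ∫ x in a..t, (x - a) ^ k = (t - a) ^ (k + 1) / (k + 1) := by
    intro k t
    rw [intervalIntegral.integral_comp_sub_right (fun x => x ^ k) a, integral_pow]
    simp
  have hiter : ∀ (k : ℕ) (u v : C(Icc a b, E)) (t : Icc a b),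
      ‖(T^[k] u) t - (T^[k] v) t‖ ≤ K ^ k * ((t - a) ^ k / k.factorial) * ‖u - v‖ := by
    intro k u v
    induction k with
    | zero => intro t; simpa using (u - v).norm_coe_le_norm t
    | succ k ih =>
      intro t
      rw [Function.iterate_succ_apply', Function.iterate_succ_apply', hT, hT,
        add_sub_add_left_eq_sub, ← intervalIntegral.integral_sub (hint' _ t t.2) (hint' _ t t.2)]
      refine (intervalIntegral.norm_integral_le_of_norm_le
        (g := fun x => K * (K ^ k * ((x - a) ^ k / k.factorial) * ‖u - v‖)) t.2.1 ?_
        (Continuous.intervalIntegrable (by fun_prop) _ _)).trans_eq ?_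
      · filter_upwards [hΦ'] with x hx hxt
        have hxm : x ∈ Icc a b := ⟨hxt.1.le, hxt.2.trans t.2.2⟩
        refine (hx ⟨hxt.1, hxm.2⟩ _ _).trans ?_
        gcongr
        have h1 := ih ⟨x, hxm⟩
        simpa only [ext, IccExtend_of_mem _ _ hxm] using h1
      · simp only [div_eq_mul_inv]
        rw [intervalIntegral.integral_const_mul, intervalIntegral.integral_mul_const,
          intervalIntegral.integral_const_mul, intervalIntegral.integral_mul_const, hpow,
          Nat.factorial_succ]
        push_cast
        field_simp
        ring
  obtain ⟨k, hk⟩ : ∃ k : ℕ, (K * (b - a)) ^ k / k.factorial < 1 :=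
    ((FloorSemiring.tendsto_pow_div_factorial_atTop (K * (b - a))).eventually_lt_const
      one_pos).exists
  have hk0 : 0 ≤ (K * (b - a)) ^ k / k.factorial := by
    have := sub_nonneg.2 hab
    positivity
  have hcontr : ∀ u v, ‖T^[k] u - T^[k] v‖ ≤ (K * (b - a)) ^ k / k.factorial * ‖u - v‖ := by
    intro u v
    rw [ContinuousMap.norm_le _ (by positivity)]
    intro t
    refine (hiter k u v t).trans ?_
    rw [mul_pow, mul_div_assoc]
    have := sub_nonneg.2 t.2.1
    gcongr
    exact t.2.2
  obtain ⟨u, hu⟩ := exists_fixedPoint_of_norm_sub_le hk0 hk hcontr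
  -- `T u` is a second fixed point of the contraction `T^[k]`, hence equal to `u`.
  have hTu : T u = u := by
    have h1 := hcontr (T u) u
    rw [← Function.iterate_succ_apply, Function.iterate_succ_apply', hu] at h1
    have h2 : ‖T u - u‖ = 0 := by nlinarith [norm_nonneg (T u - u)]
    exact sub_eq_zero.1 (norm_eq_zero.1 h2)
  refine ⟨ext u, hext u, fun t ht => ?_⟩
  rw [← hT u ⟨t, ht⟩, hTu]
  exact IccExtend_of_mem _ _ ht

/-! ### Coercive matrix functions -/

section Matrix

variable {a b : ℝ} {d : ℕ}

theorem toEuclideanLin_toEuclideanLin (M N : Matrix (Fin d) (Fin d) ℝ)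
    (v : EuclideanSpace ℝ (Fin d)) :
    M.toEuclideanLin (N.toEuclideanLin v) = (M * N).toEuclideanLin v := by
  ext i
  simp [Matrix.mulVec_mulVec]

theorem toEuclideanLin_one_apply (v : EuclideanSpace ℝ (Fin d)) :
    (1 : Matrix (Fin d) (Fin d) ℝ).toEuclideanLin v = v := by
  ext i
  simp

theorem inner_toEuclideanLin {ι : Type*} [Fintype ι] [DecidableEq ι] (M : Matrix ι ι ℝ)
    (v w : EuclideanSpace ℝ ι) :
    inner ℝ (M.toEuclideanLin v) w = inner ℝ v (M.transpose.toEuclideanLin w) := by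
  rw [← Matrix.conjTranspose_eq_transpose_of_trivial,
    Matrix.toEuclideanLin_conjTranspose_eq_adjoint, LinearMap.adjoint_inner_right]

theorem isUnit_det_of_coercive {M : Matrix (Fin d) (Fin d) ℝ} {c : ℝ} (hc : 0 < c)
    (h : ∀ v : EuclideanSpace ℝ (Fin d), c * ‖v‖ ^ 2 ≤ inner ℝ (M.toEuclideanLin v) v) :
    IsUnit M.det := by
  rw [isUnit_iff_ne_zero]
  intro h0
  obtain ⟨v, hv, hMv⟩ := Matrix.exists_mulVec_eq_zero_iff.2 h0
  have h1 := h (WithLp.toLp 2 v)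
  have h2 : M.toEuclideanLin (WithLp.toLp 2 v) = 0 := by
    ext i; simp [hMv]
  rw [h2, inner_zero_left] at h1
  have h3 : (WithLp.toLp 2 v : EuclideanSpace ℝ (Fin d)) ≠ 0 := by simpa using hv
  have := norm_pos_iff.2 h3
  have : 0 < c * ‖(WithLp.toLp 2 v : EuclideanSpace ℝ (Fin d))‖ ^ 2 := by positivity
  linarith

theorem norm_toEuclideanLin_inv_le {M : Matrix (Fin d) (Fin d) ℝ} {c : ℝ} (hc : 0 < c)
    (h : ∀ v : EuclideanSpace ℝ (Fin d), c * ‖v‖ ^ 2 ≤ inner ℝ (M.toEuclideanLin v) v)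
    (v : EuclideanSpace ℝ (Fin d)) : ‖M⁻¹.toEuclideanLin v‖ ≤ c⁻¹ * ‖v‖ := by
  set w := M⁻¹.toEuclideanLin v
  have hw : M.toEuclideanLin w = v := by
    rw [toEuclideanLin_toEuclideanLin, Matrix.mul_nonsing_inv _ (isUnit_det_of_coercive hc h),
      toEuclideanLin_one_apply]
  have h1 := (h w).trans (real_inner_le_norm _ _)
  rw [hw] at h1
  rw [inv_mul_eq_div, le_div_iff₀ hc]
  rcases (norm_nonneg w).eq_or_lt with h0 | h0
  · rw [← h0]; simp
  · nlinarith

variable {S T : ℝ → Matrix (Fin d) (Fin d) ℝ}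

theorem MemLInfty.add (hS : MemLInfty a b S) (hT : MemLInfty a b T) :
    MemLInfty a b (fun x => S x + T x) := fun i j => (hS i j).add (hT i j)

theorem MemLInfty.mul (hS : MemLInfty a b S) (hT : MemLInfty a b T) :
    MemLInfty a b (fun x => S x * T x) := fun i j => by
  simp only [Matrix.mul_apply]
  exact memLp_finsetSum _ fun k _ => (hT k j).mul (hS i k)

theorem memLInfty_const (M : Matrix (Fin d) (Fin d) ℝ) : MemLInfty a b (fun _ => M) := fun _ _ =>
  memLp_const _

/-- The pointwise inverse of a uniformly coercive bounded matrix function is bounded. -/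
theorem MemLInfty.inv (hS : MemLInfty a b S) {c : ℝ} (hc : 0 < c)
    (h : ∀ᵐ x ∂(intervalMeasure a b), ∀ v : EuclideanSpace ℝ (Fin d),
      c * ‖v‖ ^ 2 ≤ inner ℝ ((S x).toEuclideanLin v) v) :
    MemLInfty a b (fun x => (S x)⁻¹) := by
  intro i j
  have hmeas : AEMeasurable (fun x i j => S x i j) (intervalMeasure a b) :=
    aemeasurable_pi_lambda _ fun i => aemeasurable_pi_lambda _ fun j => (hS i j).1.aemeasurable
  have hdet : Measurable fun M : Fin d → Fin d → ℝ => (Matrix.of M).det :=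
    Continuous.measurable (Continuous.matrix_det (A := fun M : Fin d → Fin d → ℝ => Matrix.of M)
      continuous_id)
  have hadj : Measurable fun M : Fin d → Fin d → ℝ => (Matrix.of M).adjugate i j :=
    Continuous.measurable (Continuous.matrix_elem (Continuous.matrix_adjugate
      (A := fun M : Fin d → Fin d → ℝ => Matrix.of M) continuous_id) i j)
  have hinv : Measurable fun M : Fin d → Fin d → ℝ => (Matrix.of M)⁻¹ i j := by
    simp only [Matrix.inv_def, Matrix.smul_apply, smul_eq_mul, Ring.inverse_eq_inv']
    exact hdet.inv.mul hadj
  refine MemLp.of_bound (C := c⁻¹) (hinv.comp_aemeasurable hmeas).aestronglyMeasurable ?_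
  filter_upwards [h] with x hx
  have h1 := norm_toEuclideanLin_inv_le hc hx (EuclideanSpace.single j 1)
  have h2 := PiLp.norm_apply_le ((S x)⁻¹.toEuclideanLin (EuclideanSpace.single j 1)) i
  simp at h1 h2
  exact h2.trans h1

theorem MemLInfty.memLp_mulFun (hS : MemLInfty a b S) {v : ℝ → EuclideanSpace ℝ (Fin d)}
    (hv : MemLp v 2 (intervalMeasure a b)) : MemLp (mulFun S v) 2 (intervalMeasure a b) := by
  refine (memLp_congr_ae ?_).1 (PortHamiltonian.memLp_mulFun hS (hv.toLp v))
  filter_upwards [hv.coeFn_toLp] with x hx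
  simp only [mulFun, hx]

end Matrix

/-! ### The resolvent equation -/

section Resolvent

variable {a b : ℝ} {d : ℕ}

/-- The initial value problem for the equation `R y + ∑ P_k y^(k) = f` of order `n ≥ 1`, written
as a first order system for `(y, …, y^(n-1))`. -/
theorem exists_isSobolevChain_of_initial {m : ℕ} (hab : a < b)
    {P : ℕ → Matrix (Fin d) (Fin d) ℝ} (hPn : (P (m + 1)).det ≠ 0)
    {R : ℝ → Matrix (Fin d) (Fin d) ℝ} (hR : MemLInfty a b R) {C : ℝ} (hC : 0 ≤ C)
    (hRC : ∀ᵐ x ∂(intervalMeasure a b), ∀ v : EuclideanSpace ℝ (Fin d),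
      ‖(R x).toEuclideanLin v‖ ≤ C * ‖v‖)
    {f : ℝ → EuclideanSpace ℝ (Fin d)} (hf : MemLp f 2 (intervalMeasure a b))
    (α : Fin (m + 1) → EuclideanSpace ℝ (Fin d)) :
    ∃ Y : ℕ → ℝ → EuclideanSpace ℝ (Fin d), IsSobolevChain a b (m + 1) Y ∧
      (∀ k : Fin (m + 1), Y k a = α k) ∧
      ∀ᵐ x ∂(intervalMeasure a b), (R x).toEuclideanLin (Y 0 x) +
        ∑ k ∈ Finset.range (m + 2), Matrix.toEuclideanCLM (𝕜 := ℝ) (P k) (Y k x) = f x := by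
  let E := EuclideanSpace ℝ (Fin d)
  let L : ℕ → E →L[ℝ] E := fun k => Matrix.toEuclideanCLM (𝕜 := ℝ) (P k)
  let Pinv : E →L[ℝ] E := Matrix.toEuclideanCLM (𝕜 := ℝ) (P (m + 1))⁻¹
  have hPinv : ∀ v, L (m + 1) (Pinv v) = v := by
    intro v
    change (L (m + 1) * Pinv) v = v
    simp only [L, Pinv]
    rw [← map_mul, Matrix.mul_nonsing_inv _ (isUnit_iff_ne_zero.2 hPn), map_one]
    rfl
  let top : ℝ → (Fin (m + 1) → E) → E := fun x v =>
    Pinv (f x - (R x).toEuclideanLin (v 0) - ∑ k : Fin (m + 1), L k (v k))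
  have htop_sub : ∀ x v w, top x v - top x w =
      Pinv (-(R x).toEuclideanLin ((v - w) 0) - ∑ k : Fin (m + 1), L k ((v - w) k)) := by
    intro x v w
    simp only [top]
    rw [← map_sub]
    congr 1
    simp only [Pi.sub_apply, map_sub, Finset.sum_sub_distrib]
    abel
  have htop : ∀ u : ℝ → Fin (m + 1) → E, Continuous u →
      MemLp (fun x => top x (u x)) 2 (intervalMeasure a b) := by
    intro u hu
    have hcomp : ∀ k, MemLp (fun x => u x k) 2 (intervalMeasure a b) := fun k =>
      memLp_of_continuousOn ((continuous_apply k).comp hu).continuousOn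
    refine Pinv.comp_memLp' (f := fun x =>
      f x - (R x).toEuclideanLin (u x 0) - ∑ k : Fin (m + 1), L k (u x k)) ?_
    exact (hf.sub (hR.memLp_mulFun (hcomp 0))).sub
      (memLp_finsetSum _ fun k _ => (L k).comp_memLp' (hcomp k))
  let Φ : ℝ → (Fin (m + 1) → E) → (Fin (m + 1) → E) := fun x v k =>
    if h : (k : ℕ) + 1 < m + 1 then v ⟨k + 1, h⟩ else top x v
  set K := max 1 (‖Pinv‖ * (C + ∑ k : Fin (m + 1), ‖L k‖)) with hK
  have hK1 : (1 : ℝ) ≤ K := le_max_left _ _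
  have hK0 : 0 ≤ K := zero_le_one.trans hK1
  have hΦ : ∀ᵐ x ∂(intervalMeasure a b), ∀ v w, ‖Φ x v - Φ x w‖ ≤ K * ‖v - w‖ := by
    filter_upwards [hRC] with x hx v w
    rw [pi_norm_le_iff_of_nonneg (by positivity)]
    intro k
    simp only [Pi.sub_apply, Φ]
    split_ifs with h
    · refine (norm_le_pi_norm (v - w) _).trans ?_
      exact le_mul_of_one_le_left (norm_nonneg _) hK1
    · rw [htop_sub]
      calc _ ≤ ‖Pinv‖ * ((C + ∑ k : Fin (m + 1), ‖L k‖) * ‖v - w‖) := by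
            refine (Pinv.le_opNorm _).trans ?_
            gcongr
            refine (norm_sub_le _ _).trans ?_
            rw [norm_neg, add_mul, Finset.sum_mul]
            refine add_le_add ((hx _).trans ?_) ((norm_sum_le _ _).trans ?_)
            · gcongr; exact norm_le_pi_norm (v - w) 0
            · refine Finset.sum_le_sum fun k _ => ((L k).le_opNorm _).trans ?_
              gcongr; exact norm_le_pi_norm (v - w) k
        _ ≤ _ := by
            rw [← mul_assoc]
            gcongr
            exact le_max_right _ _
  have hint : ∀ u : ℝ → Fin (m + 1) → E, Continuous u →
      IntervalIntegrable (fun x => Φ x (u x)) volume a b := by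
    intro u hu
    rw [intervalIntegrable_iff_integrableOn_Ioo_of_le hab.le]
    refine Integrable.of_eval fun k => ?_
    simp only [Φ]
    split_ifs with h
    · exact integrableOn_of_memLp
        (memLp_of_continuousOn ((continuous_apply _).comp hu).continuousOn)
    · exact integrableOn_of_memLp (htop u hu)
  obtain ⟨u, hu, hueq⟩ := exists_continuous_eq_add_integral hab.le hK0 hΦ hint α
  have hua : u a = α := by simpa using hueq a (left_mem_Icc.2 hab.le)
  have hprim : IsPrimitive a b u (fun x => Φ x (u x)) :=
    ⟨hint u hu, fun t ht => by rw [hua]; exact hueq t ht⟩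
  let Y : ℕ → ℝ → E := fun k x => if h : k < m + 1 then u x ⟨k, h⟩ else top x (u x)
  have hYlt : ∀ k : Fin (m + 1), Y k = fun x => u x k := fun k => by
    funext x; simp only [Y, dif_pos k.2]
  have hYtop : Y (m + 1) = fun x => top x (u x) := by
    funext x; simp only [Y, dif_neg (lt_irrefl _)]
  refine ⟨Y, IsSobolevChain.of_isPrimitive hab.le (fun k hk => ?_) ?_, fun k => ?_, ?_⟩
  · have h1 := hprim.clm_comp (ContinuousLinearMap.proj (R := ℝ) (⟨k, hk⟩ : Fin (m + 1)))
    rw [hYlt ⟨k, hk⟩]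
    exact h1
  · rw [hYtop]; exact htop u hu
  · rw [hYlt]
    exact congrFun hua k
  · refine Filter.Eventually.of_forall fun x => ?_
    change (R x).toEuclideanLin (Y 0 x) + ∑ k ∈ Finset.range (m + 2), L k (Y k x) = f x
    rw [Finset.sum_range_succ, hYtop, hPinv, Finset.sum_range, show Y 0 = _ from hYlt 0]
    simp only [hYlt]
    abel

variable {P : ℕ → Matrix (Fin d) (Fin d) ℝ} {𝓗 : ℝ → Matrix (Fin d) (Fin d) ℝ}

theorem inner_toEuclideanLin_self_of_transpose_eq_neg {M : Matrix (Fin d) (Fin d) ℝ}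
    (hM : M.transpose = -M) (v : EuclideanSpace ℝ (Fin d)) :
    inner ℝ (M.toEuclideanLin v) v = 0 := by
  have h1 := inner_toEuclideanLin M v v
  rw [hM, map_neg, LinearMap.neg_apply, inner_neg_right] at h1
  linarith [real_inner_comm v (M.toEuclideanLin v)]

/-- The equation `u + A u = f` is solvable for arbitrary values of `tr_a (𝓗 u)`. -/
theorem exists_resolvent_solution {n : ℕ} (hab : a < b)
    (hP : ∀ j ≤ n, (P j).transpose = (-1 : ℝ) ^ (j + 1) • P j) (hPn : (P n).det ≠ 0)
    (h𝓗 : MemLInfty a b 𝓗) (h𝓗symm : ∀ᵐ x ∂(intervalMeasure a b), (𝓗 x).IsSymm)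
    {c : ℝ} (hc : 0 < c) (h𝓗c : ∀ᵐ x ∂(intervalMeasure a b),
      ∀ v : EuclideanSpace ℝ (Fin d), c * ‖v‖ ^ 2 ≤ inner ℝ ((𝓗 x).toEuclideanLin v) v)
    {f : ℝ → EuclideanSpace ℝ (Fin d)} (hf : MemLp f 2 (intervalMeasure a b))
    (α : Fin n → EuclideanSpace ℝ (Fin d)) :
    ∃ (u : ℝ → EuclideanSpace ℝ (Fin d)) (Y : ℕ → ℝ → EuclideanSpace ℝ (Fin d)),
      MemLp u 2 (intervalMeasure a b) ∧ IsSobolevChain a b n Y ∧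
      (∀ k : Fin n, Y k a = α k) ∧ mulFun 𝓗 u =ᵐ[intervalMeasure a b] Y 0 ∧
      ∀ᵐ x ∂(intervalMeasure a b), u x +
        ∑ k ∈ Finset.range (n + 1), Matrix.toEuclideanCLM (𝕜 := ℝ) (P k) (Y k x) = f x := by
  rcases n with _ | m
  · -- `u + P₀ 𝓗 u = f` becomes coercive after multiplication by `𝓗`, as `𝓗 P₀ 𝓗` is skew.
    have hS := h𝓗.add ((h𝓗.mul (memLInfty_const (P 0))).mul h𝓗)
    have hP0 : (P 0).transpose = -P 0 := by simpa using hP 0 le_rfl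
    have hSc : ∀ᵐ x ∂(intervalMeasure a b), ∀ v : EuclideanSpace ℝ (Fin d),
        c * ‖v‖ ^ 2 ≤ inner ℝ ((𝓗 x + 𝓗 x * P 0 * 𝓗 x).toEuclideanLin v) v := by
      filter_upwards [h𝓗symm, h𝓗c] with x hx hxc v
      have hskew : (𝓗 x * P 0 * 𝓗 x).transpose = -(𝓗 x * P 0 * 𝓗 x) := by
        rw [Matrix.transpose_mul, Matrix.transpose_mul, hx.eq, hP0, Matrix.neg_mul, Matrix.mul_neg,
          Matrix.mul_assoc]
      rw [map_add, LinearMap.add_apply, inner_add_left,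
        inner_toEuclideanLin_self_of_transpose_eq_neg hskew, add_zero]
      exact hxc v
    have hu := (hS.inv hc hSc).memLp_mulFun (h𝓗.memLp_mulFun hf)
    set u := mulFun (fun x => (𝓗 x + 𝓗 x * P 0 * 𝓗 x)⁻¹) (mulFun 𝓗 f) with hudef
    refine ⟨u, fun _ => mulFun 𝓗 u, hu, ⟨fun k hk => absurd hk (Nat.not_lt_zero k), fun k _ =>
      h𝓗.memLp_mulFun hu⟩, fun k => k.elim0, Filter.EventuallyEq.rfl, ?_⟩
    filter_upwards [h𝓗c, hSc] with x hx hSx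
    have h1 : (𝓗 x + 𝓗 x * P 0 * 𝓗 x).toEuclideanLin (u x) = (𝓗 x).toEuclideanLin (f x) := by
      simp only [hudef, mulFun]
      rw [toEuclideanLin_toEuclideanLin, Matrix.mul_nonsing_inv _ (isUnit_det_of_coercive hc hSx),
        toEuclideanLin_one_apply]
    have h2 : (𝓗 x).toEuclideanLin (u x + (P 0).toEuclideanLin (mulFun 𝓗 u x)) =
        (𝓗 x).toEuclideanLin (f x) := by
      rw [← h1, map_add, map_add, mulFun, toEuclideanLin_toEuclideanLin,
        toEuclideanLin_toEuclideanLin, LinearMap.add_apply, Matrix.mul_assoc]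
    have h3 := congrArg ((𝓗 x)⁻¹.toEuclideanLin) h2
    simp only [toEuclideanLin_toEuclideanLin, toEuclideanLin_one_apply,
      Matrix.nonsing_inv_mul _ (isUnit_det_of_coercive hc hx)] at h3
    simp only [zero_add, Finset.sum_range_one]
    exact h3
  · obtain ⟨Y, hY, hYa, hYeq⟩ := exists_isSobolevChain_of_initial hab hPn (h𝓗.inv hc h𝓗c)
      (inv_nonneg.2 hc.le)
      (h𝓗c.mono fun x hx v => norm_toEuclideanLin_inv_le hc hx v) hf α
    refine ⟨mulFun (fun x => (𝓗 x)⁻¹) (Y 0), Y,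
      (h𝓗.inv hc h𝓗c).memLp_mulFun (hY.2 0 (Nat.zero_le _)), hY, hYa, ?_, hYeq⟩
    filter_upwards [h𝓗c] with x hx
    simp only [mulFun]
    rw [toEuclideanLin_toEuclideanLin, Matrix.mul_nonsing_inv _ (isUnit_det_of_coercive hc hx),
      toEuclideanLin_one_apply]

end Resolvent

/-! ### The positive part of a symmetric operator -/

section PositiveRoot

variable {E : Type*} [NormedAddCommGroup E] [InnerProductSpace ℝ E] {T : E →ₗ[ℝ] E}

theorem inner_eq_zero_of_mem_positiveSpace (hT : T.IsSymmetric) {x : E} {l : ℝ} (hl : l ≤ 0)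
    (hx : T x = l • x) {v : E} (hv : v ∈ positiveSpace T) : inner ℝ x v = 0 := by
  induction hv using Submodule.span_induction with
  | mem v hv =>
    obtain ⟨μ, hμ, hv⟩ := hv
    have h1 := hT x v
    rw [hx, hv, inner_smul_left, inner_smul_right, conj_trivial] at h1
    have h2 : (l - μ) * inner ℝ x v = 0 := by rw [sub_mul, h1, sub_self]
    exact (mul_eq_zero.1 h2).resolve_left (by linarith)
  | zero => exact inner_zero_right _
  | add v w _ _ hv hw => rw [inner_add_right, hv, hw, add_zero]
  | smul c v _ hv => rw [inner_smul_right, hv, mul_zero]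

theorem inner_eq_zero_of_mem_positiveSpace_neg (hT : T.IsSymmetric) {x v : E}
    (hx : x ∈ positiveSpace (-T)) (hv : v ∈ positiveSpace T) : inner ℝ x v = 0 := by
  induction hx using Submodule.span_induction with
  | mem x hx =>
    obtain ⟨μ, hμ, hx⟩ := hx
    refine inner_eq_zero_of_mem_positiveSpace hT (l := -μ) (by linarith) ?_ hv
    rw [neg_smul, ← hx, LinearMap.neg_apply, neg_neg]
  | zero => exact inner_zero_left _
  | add x w _ _ hx hw => rw [inner_add_left, hx, hw, add_zero]
  | smul c x _ hx => rw [inner_smul_left, hx, mul_zero]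

theorem apply_mem_positiveSpace {v : E} (hv : v ∈ positiveSpace T) : T v ∈ positiveSpace T := by
  induction hv using Submodule.span_induction with
  | mem v hv =>
    obtain ⟨μ, hμ, h⟩ := hv
    rw [h]
    exact Submodule.smul_mem _ _ (Submodule.subset_span ⟨μ, hμ, h⟩)
  | zero => rw [map_zero]; exact Submodule.zero_mem _
  | add v w _ _ hv hw => rw [map_add]; exact Submodule.add_mem _ hv hw
  | smul c v _ hv => rw [map_smul]; exact Submodule.smul_mem _ _ hv

theorem isSymmetric_neg (hT : T.IsSymmetric) : (-T).IsSymmetric := fun x y => by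
  simp only [LinearMap.neg_apply, inner_neg_left, inner_neg_right, hT x y]

variable [FiniteDimensional ℝ E]

theorem exists_isPositive_comp_self_eq (hT : T.IsPositive) :
    ∃ S : E →ₗ[ℝ] E, S.IsPositive ∧ S ∘ₗ S = T := by
  let b := hT.1.eigenvectorBasis rfl
  let l := hT.1.eigenvalues rfl
  have hb : ∀ i, T (b i) = l i • b i := fun i => hT.1.apply_eigenvectorBasis rfl i
  have hl : ∀ i, 0 ≤ l i := by
    intro i
    have h1 := hT.2 (b i)
    rw [hb] at h1
    simpa [inner_smul_left] using h1
  let S : E →ₗ[ℝ] E := ∑ i, √(l i) • (innerₛₗ ℝ (b i)).smulRight (b i)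
  have hS : ∀ x, S x = ∑ i, √(l i) • inner ℝ (b i) x • b i := fun x => by
    simp [S, LinearMap.sum_apply]
  have hinner : ∀ x y, inner ℝ (S x) y = ∑ i, √(l i) * inner ℝ (b i) x * inner ℝ (b i) y := by
    intro x y
    rw [hS, sum_inner]
    simp only [inner_smul_left, conj_trivial, mul_assoc]
  have hSb : ∀ i, S (b i) = √(l i) • b i := by
    intro i
    rw [hS, Finset.sum_eq_single i]
    · simp
    · intro j _ hj
      rw [b.inner_eq_zero hj, zero_smul, smul_zero]
    · simp
  refine ⟨S, ⟨fun x y => ?_, fun x => ?_⟩, ?_⟩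
  · rw [hinner, real_inner_comm, hinner]
    exact Finset.sum_congr rfl fun i _ => by ring
  · rw [hinner]
    simp only [RCLike.re_to_real, mul_assoc]
    exact Finset.sum_nonneg fun i _ => mul_nonneg (Real.sqrt_nonneg _) (mul_self_nonneg _)
  · refine b.toBasis.ext fun i => ?_
    simp only [OrthonormalBasis.coe_toBasis, LinearMap.comp_apply]
    rw [hSb, map_smul, hSb, smul_smul, Real.mul_self_sqrt (hl i), hb]

theorem positiveSqrt_spec (hT : T.IsPositive) :
    (positiveSqrt T).IsPositive ∧ positiveSqrt T ∘ₗ positiveSqrt T = T := by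
  have h := exists_isPositive_comp_self_eq hT
  rw [positiveSqrt, dif_pos h]
  exact h.choose_spec

theorem inner_apply_self_nonneg_of_mem_positiveSpace (hT : T.IsSymmetric) {v : E}
    (hv : v ∈ positiveSpace T) : 0 ≤ inner ℝ (T v) v := by
  let b := hT.eigenvectorBasis rfl
  rw [← b.sum_inner_mul_inner]
  refine Finset.sum_nonneg fun i _ => ?_
  have hb : T (b i) = hT.eigenvalues rfl i • b i := hT.apply_eigenvectorBasis rfl i
  rw [hT, hb, inner_smul_right, real_inner_comm (b i) v, mul_assoc]
  rcases le_or_gt (hT.eigenvalues rfl i) 0 with h | h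
  · rw [inner_eq_zero_of_mem_positiveSpace hT h hb hv]
    simp
  · exact mul_nonneg h.le (mul_self_nonneg _)

theorem isPositive_compress_positiveSpace (hT : T.IsSymmetric) :
    (LinearMap.adjoint (positiveSpace T).subtype ∘ₗ T ∘ₗ (positiveSpace T).subtype).IsPositive := by
  refine ⟨fun x y => ?_, fun x => ?_⟩
  · simp only [LinearMap.comp_apply, LinearMap.adjoint_inner_left, LinearMap.adjoint_inner_right]
    exact hT _ _
  · simp only [LinearMap.comp_apply, LinearMap.adjoint_inner_left, RCLike.re_to_real]
    exact inner_apply_self_nonneg_of_mem_positiveSpace hT x.2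

theorem adjoint_subtype_apply_coe (V : Submodule ℝ E) (v : V) :
    LinearMap.adjoint V.subtype (v : E) = v := by
  refine ext_inner_right ℝ fun w => ?_
  rw [LinearMap.adjoint_inner_left]
  rfl

theorem adjoint_subtype_eq_zero {V : Submodule ℝ E} {x : E} (hx : ∀ v ∈ V, inner ℝ x v = 0) :
    LinearMap.adjoint V.subtype x = 0 := by
  refine ext_inner_right ℝ fun w => ?_
  rw [LinearMap.adjoint_inner_left, inner_zero_left]
  exact hx _ w.2

theorem positiveRoot_apply (x : E) : positiveRoot T x =
    (positiveSqrt (LinearMap.adjoint (positiveSpace T).subtype ∘ₗ T ∘ₗ (positiveSpace T).subtype)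
      (LinearMap.adjoint (positiveSpace T).subtype x) : E) := rfl

theorem isSymmetric_positiveRoot (hT : T.IsSymmetric) : (positiveRoot T).IsSymmetric := by
  intro x y
  have h := (positiveSqrt_spec (isPositive_compress_positiveSpace hT)).1.1
  have h1 := h (LinearMap.adjoint (positiveSpace T).subtype x)
    (LinearMap.adjoint (positiveSpace T).subtype y)
  rwa [LinearMap.adjoint_inner_right, LinearMap.adjoint_inner_left] at h1

theorem positiveRoot_mem (x : E) : positiveRoot T x ∈ positiveSpace T := by
  rw [positiveRoot_apply]
  exact Subtype.coe_prop _

theorem positiveRoot_positiveRoot (hT : T.IsSymmetric) (x : E) :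
    positiveRoot T (positiveRoot T x) = T (LinearMap.adjoint (positiveSpace T).subtype x) := by
  have h := (positiveSqrt_spec (isPositive_compress_positiveSpace hT)).2
  rw [positiveRoot_apply (positiveRoot T x), positiveRoot_apply x, adjoint_subtype_apply_coe,
    ← LinearMap.comp_apply, h]
  have h1 := adjoint_subtype_apply_coe (positiveSpace T)
    ⟨_, apply_mem_positiveSpace (Subtype.coe_prop (LinearMap.adjoint (positiveSpace T).subtype x))⟩
  exact congrArg Subtype.val h1

theorem positiveRoot_neg_positiveRoot (hT : T.IsSymmetric) (x : E) :
    positiveRoot (-T) (positiveRoot T x) = 0 := by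
  rw [positiveRoot_apply, adjoint_subtype_eq_zero, map_zero, Submodule.coe_zero]
  intro v hv
  rw [real_inner_comm]
  exact inner_eq_zero_of_mem_positiveSpace_neg hT hv (positiveRoot_mem x)

/-- `Q₊² - Q₋² = Q`. -/
theorem positiveRoot_sq_sub_sq (hT : T.IsSymmetric) (x : E) :
    positiveRoot T (positiveRoot T x) - positiveRoot (-T) (positiveRoot (-T) x) = T x := by
  have hT' := isSymmetric_neg hT
  rw [positiveRoot_positiveRoot hT, positiveRoot_positiveRoot hT', LinearMap.neg_apply,
    sub_neg_eq_add]
  let b := hT.eigenvectorBasis rfl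
  have hb : ∀ i, T (b i) = hT.eigenvalues rfl i • b i := hT.apply_eigenvectorBasis rfl
  have key : T ∘ₗ (positiveSpace T).subtype ∘ₗ LinearMap.adjoint (positiveSpace T).subtype +
      T ∘ₗ (positiveSpace (-T)).subtype ∘ₗ LinearMap.adjoint (positiveSpace (-T)).subtype = T := by
    refine b.toBasis.ext fun i => ?_
    simp only [OrthonormalBasis.coe_toBasis, LinearMap.add_apply, LinearMap.comp_apply,
      Submodule.subtype_apply]
    have hb' : (-T) (b i) = (-hT.eigenvalues rfl i) • b i := by
      rw [LinearMap.neg_apply, hb, neg_smul]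
    rcases lt_trichotomy (hT.eigenvalues rfl i) 0 with h | h | h
    · have hmem : b i ∈ positiveSpace (-T) := Submodule.subset_span ⟨_, neg_pos.2 h, hb'⟩
      rw [adjoint_subtype_eq_zero fun v hv =>
        inner_eq_zero_of_mem_positiveSpace hT h.le (hb i) hv]
      have := congrArg Subtype.val (adjoint_subtype_apply_coe (positiveSpace (-T)) ⟨b i, hmem⟩)
      simp only at this
      rw [this]
      simp
    · rw [adjoint_subtype_eq_zero fun v hv =>
          inner_eq_zero_of_mem_positiveSpace hT h.le (hb i) hv,
        adjoint_subtype_eq_zero fun v hv =>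
          inner_eq_zero_of_mem_positiveSpace hT' (by rw [h, neg_zero]) hb' hv, hb, h]
      simp
    · have hmem : b i ∈ positiveSpace T := Submodule.subset_span ⟨_, h, hb i⟩
      rw [adjoint_subtype_eq_zero (V := positiveSpace (-T)) fun v hv =>
        inner_eq_zero_of_mem_positiveSpace hT' (by linarith) hb' hv]
      have := congrArg Subtype.val (adjoint_subtype_apply_coe (positiveSpace T) ⟨b i, hmem⟩)
      simp only at this
      rw [this]
      simp
  exact LinearMap.congr_fun key x

theorem inner_positiveRoot_positiveRoot_neg (hT : T.IsSymmetric) (x y : E) :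
    inner ℝ (positiveRoot T x) (positiveRoot (-T) y) = 0 := by
  rw [← isSymmetric_positiveRoot (isSymmetric_neg hT), positiveRoot_neg_positiveRoot hT,
    inner_zero_left]

theorem norm_sq_add_positiveRoot (hT : T.IsSymmetric) (x y : E) :
    ‖positiveRoot T x + positiveRoot (-T) y‖ ^ 2 =
      ‖positiveRoot T x‖ ^ 2 + ‖positiveRoot (-T) y‖ ^ 2 := by
  rw [norm_add_sq_real, inner_positiveRoot_positiveRoot_neg hT]
  ring

theorem inner_apply_self_eq_norm_sq_sub (hT : T.IsSymmetric) (x : E) :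
    inner ℝ (T x) x = ‖positiveRoot T x‖ ^ 2 - ‖positiveRoot (-T) x‖ ^ 2 := by
  rw [← positiveRoot_sq_sub_sq hT, inner_sub_left, isSymmetric_positiveRoot hT,
    isSymmetric_positiveRoot (isSymmetric_neg hT), real_inner_self_eq_norm_sq,
    real_inner_self_eq_norm_sq]

/-- The form `⟨T y, y⟩ - ⟨T x, x⟩` as a difference of squares of boundary values. -/
theorem norm_sq_boundary_sub (hT : T.IsSymmetric) (x y : E) :
    ‖positiveRoot T y + positiveRoot (-T) x‖ ^ 2 - ‖positiveRoot (-T) y + positiveRoot T x‖ ^ 2 =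
      inner ℝ (T y) y - inner ℝ (T x) x := by
  rw [norm_sq_add_positiveRoot hT, add_comm (positiveRoot (-T) y), norm_sq_add_positiveRoot hT,
    inner_apply_self_eq_norm_sq_sub hT, inner_apply_self_eq_norm_sq_sub hT]
  ring

/-- If `T` is invertible, the boundary values `(F₊, F₋)` of a pair `(x, y)` are arbitrary. -/
theorem exists_boundary_eq (hT : T.IsSymmetric) (hinj : ∀ x, T x = 0 → x = 0) (p q : E) :
    ∃ x y, positiveRoot T y + positiveRoot (-T) x = p ∧
      positiveRoot (-T) y + positiveRoot T x = q := by
  let M : E × E →ₗ[ℝ] E × E :=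
    (positiveRoot T ∘ₗ LinearMap.snd ℝ E E + positiveRoot (-T) ∘ₗ LinearMap.fst ℝ E E).prod
      (positiveRoot (-T) ∘ₗ LinearMap.snd ℝ E E + positiveRoot T ∘ₗ LinearMap.fst ℝ E E)
  have hsplit : ∀ x y, positiveRoot T x + positiveRoot (-T) y = 0 →
      positiveRoot T x = 0 ∧ positiveRoot (-T) y = 0 := by
    intro x y h
    have h1 := norm_sq_add_positiveRoot hT x y
    rw [h, norm_zero] at h1
    constructor <;> rw [← norm_eq_zero] <;>
      nlinarith [sq_nonneg ‖positiveRoot T x‖, sq_nonneg ‖positiveRoot (-T) y‖]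
  have hzero : ∀ x, positiveRoot T x = 0 → positiveRoot (-T) x = 0 → x = 0 := by
    intro x h1 h2
    refine hinj x ?_
    rw [← positiveRoot_sq_sub_sq hT, h1, h2, map_zero, map_zero, sub_zero]
  have hM : Function.Injective M := by
    rw [← LinearMap.ker_eq_bot, LinearMap.ker_eq_bot']
    rintro ⟨x, y⟩ h
    have h1 : positiveRoot T y + positiveRoot (-T) x = 0 := congrArg Prod.fst h
    have h2 : positiveRoot (-T) y + positiveRoot T x = 0 := congrArg Prod.snd h
    rw [add_comm] at h2
    obtain ⟨hy, hx'⟩ := hsplit _ _ h1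
    obtain ⟨hx, hy'⟩ := hsplit _ _ h2
    rw [hzero x hx hx', hzero y hy hy']
    rfl
  obtain ⟨⟨x, y⟩, h⟩ := LinearMap.injective_iff_surjective.1 hM (p, q)
  exact ⟨x, y, congrArg Prod.fst h, congrArg Prod.snd h⟩

end PositiveRoot

/-! ### The boundary matrix -/

section BoundaryMatrix

variable {n d : ℕ} {P : ℕ → Matrix (Fin d) (Fin d) ℝ}

theorem boundaryMatrix_isHermitian (hP : ∀ j ≤ n, (P j).transpose = (-1 : ℝ) ^ (j + 1) • P j) :
    (boundaryMatrix n P).IsHermitian := by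
  ext p q
  rw [Matrix.conjTranspose_apply, star_trivial]
  unfold boundaryMatrix
  by_cases h : (p.1 : ℕ) + q.1 + 1 ≤ n
  · rw [if_pos h, if_pos (by omega)]
    have h1 := congrFun (congrFun (hP _ h) q.2) p.2
    rw [Matrix.transpose_apply, Matrix.smul_apply, smul_eq_mul] at h1
    rw [h1, add_comm (q.1 : ℕ) p.1, ← mul_assoc, ← pow_add]
    congr 1
    rw [show (p.1 : ℕ) + (p.1 + q.1 + 1 + 1) = q.1 + 2 * (p.1 + 1) by ring, pow_add, pow_mul]
    simp
  · rw [if_neg h, if_neg (by omega)]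

theorem boundaryMatrix_apply_eq (x : BoundarySpace n d) (i : Fin n) (r : Fin d) :
    (boundaryMatrix n P).toEuclideanLin x (i, r) = ∑ j : Fin n, if (i : ℕ) + j + 1 ≤ n then
      (-1) ^ (i : ℕ) * (P (i + j + 1)).toEuclideanLin (WithLp.toLp 2 fun s => x (j, s)) r
      else 0 := by
  simp only [Matrix.toLpLin_apply, Matrix.mulVec, dotProduct, boundaryMatrix,
    Fintype.sum_prod_type]
  refine Finset.sum_congr rfl fun j _ => ?_
  split_ifs with h
  · rw [Finset.mul_sum]
    exact Finset.sum_congr rfl fun s _ => by ring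
  · simp

/-- The boundary matrix is block triangular with respect to the antidiagonal, with blocks `± P n`
on it. -/
theorem boundaryMatrix_injective (hPn : (P n).det ≠ 0) (x : BoundarySpace n d)
    (hx : (boundaryMatrix n P).toEuclideanLin x = 0) : x = 0 := by
  have key : ∀ k : ℕ, ∀ hk : k < n, (fun s => x (⟨k, hk⟩, s)) = 0 := by
    intro k
    induction k using Nat.strong_induction_on with
    | _ k ih =>
      intro hk
      have h1 : (P n).mulVec (fun s => x (⟨k, hk⟩, s)) = 0 := by
        funext r
        have h2 : (boundaryMatrix n P).toEuclideanLin x (⟨n - 1 - k, by omega⟩, r) = 0 := by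
          rw [hx]; rfl
        rw [boundaryMatrix_apply_eq, Finset.sum_eq_single ⟨k, hk⟩] at h2
        · have hle : n - 1 - k + k + 1 = n := by omega
          simp only [hle, le_refl, if_true, mul_eq_zero, pow_eq_zero_iff', neg_eq_zero,
            one_ne_zero, false_and, false_or] at h2
          exact h2
        · intro j _ hj
          split_ifs with hle
          · simp only at hle
            have hjk : (j : ℕ) < k := by
              have : (j : ℕ) ≠ k := fun h => hj (Fin.ext h)
              omega
            have h3 : (WithLp.toLp 2 fun s => x (j, s) : EuclideanSpace ℝ (Fin d)) = 0 := by
              rw [show (fun s => x (j, s)) = 0 from ih j hjk j.2]; rfl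
            rw [h3, map_zero]
            simp
          · rfl
        · simp
      by_contra hne
      exact hPn (Matrix.exists_mulVec_eq_zero_iff.1 ⟨_, hne, h1⟩)
  ext ⟨i, r⟩
  exact congrFun (key i i.2) r

theorem inner_boundaryMatrix_apply (y : ℕ → EuclideanSpace ℝ (Fin d)) :
    inner ℝ ((boundaryMatrix n P).toEuclideanLin (WithLp.toLp 2 fun p => y p.1 p.2))
      (WithLp.toLp 2 fun p => y p.1 p.2 : BoundarySpace n d) =
    ∑ i ∈ Finset.range n, ∑ j ∈ Finset.range (n - i),
      (-1) ^ i * inner ℝ ((P (i + j + 1)).toEuclideanLin (y j)) (y i) := by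
  rw [PiLp.inner_apply, Fintype.sum_prod_type, Finset.sum_range]
  refine Finset.sum_congr rfl fun i _ => ?_
  have h1 : Finset.range (n - i) = (Finset.range n).filter (fun j => (i : ℕ) + j + 1 ≤ n) := by
    ext j; simp; omega
  rw [h1, Finset.sum_filter, Finset.sum_range]
  simp only [RCLike.inner_apply, conj_trivial, boundaryMatrix_apply_eq, Finset.mul_sum]
  rw [Finset.sum_comm]
  refine Finset.sum_congr rfl fun j _ => ?_
  split_ifs with h
  · rw [PiLp.inner_apply, Finset.mul_sum]
    refine Finset.sum_congr rfl fun r _ => ?_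
    simp only [RCLike.inner_apply, conj_trivial]
    ring
  · simp

end BoundaryMatrix

/-! ### Green's identity and traces -/

section Green

variable {a b : ℝ} {n d : ℕ} {P : ℕ → Matrix (Fin d) (Fin d) ℝ}
  {Y : ℕ → ℝ → EuclideanSpace ℝ (Fin d)}

theorem integrable_inner_of_memLp {u v : ℝ → EuclideanSpace ℝ (Fin d)}
    (hu : MemLp u 2 (intervalMeasure a b)) (hv : MemLp v 2 (intervalMeasure a b)) :
    IntegrableOn (fun x => inner ℝ (u x) (v x)) (Ioo a b) := by
  refine (L2.integrable_inner (𝕜 := ℝ) (hu.toLp u) (hv.toLp v)).congr ?_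
  filter_upwards [hu.coeFn_toLp, hv.coeFn_toLp] with x h1 h2
  rw [h1, h2]

theorem IsSobolevChain.intervalIntegrable_inner (hY : IsSobolevChain a b n Y) (hab : a ≤ b)
    (M : Matrix (Fin d) (Fin d) ℝ) {i j : ℕ} (hi : i ≤ n) (hj : j ≤ n) :
    IntervalIntegrable (fun x => inner ℝ (M.toEuclideanLin (Y i x)) (Y j x)) volume a b := by
  rw [intervalIntegrable_iff_integrableOn_Ioo_of_le hab]
  exact integrable_inner_of_memLp
    ((Matrix.toEuclideanCLM (𝕜 := ℝ) M).comp_memLp' (hY.2 i hi)) (hY.2 j hj)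

/-- Green's identity for a single term `M ∂^m`, `m = k + 1`, with `Mᵀ = (-1)^(m+1) M`: the
alternating sum of the product rules for `⟨M y^(m-1-i), y^(i)⟩` telescopes. -/
theorem IsSobolevChain.integral_inner_term (hY : IsSobolevChain a b n Y) (hab : a ≤ b) {k : ℕ}
    (hk : k < n) {M : Matrix (Fin d) (Fin d) ℝ}
    (hM : M.transpose = (-1 : ℝ) ^ (k + 2) • M) :
    2 * ∫ x in a..b, inner ℝ (M.toEuclideanLin (Y (k + 1) x)) (Y 0 x) =
      ∑ i ∈ Finset.range (k + 1),
          (-1) ^ i * inner ℝ (M.toEuclideanLin (Y (k - i) b)) (Y i b) -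
        ∑ i ∈ Finset.range (k + 1),
          (-1) ^ i * inner ℝ (M.toEuclideanLin (Y (k - i) a)) (Y i a) := by
  let c : ℕ → ℝ := fun i => ∫ x in a..b, inner ℝ (M.toEuclideanLin (Y (k + 1 - i) x)) (Y i x)
  have hstep : ∀ i ∈ Finset.range (k + 1), c i + c (i + 1) =
      inner ℝ (M.toEuclideanLin (Y (k - i) b)) (Y i b) -
        inner ℝ (M.toEuclideanLin (Y (k - i) a)) (Y i a) := by
    intro i hi
    rw [Finset.mem_range] at hi
    have h1 := ((hY.1 (k - i) (by omega)).clm_comp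
      (Matrix.toEuclideanCLM (𝕜 := ℝ) M)).integral_inner_add_inner hab (hY.1 i (by omega))
    refine Eq.trans ?_ h1
    simp only [c]
    rw [show k + 1 - i = k - i + 1 by omega, show k + 1 - (i + 1) = k - i by omega,
      ← intervalIntegral.integral_add (hY.intervalIntegrable_inner hab M (by omega) (by omega))
        (hY.intervalIntegrable_inner hab M (by omega) (by omega))]
    rfl
  have hend : c (k + 1) = (-1) ^ (k + 2) * c 0 := by
    simp only [c]
    rw [← intervalIntegral.integral_const_mul]
    refine intervalIntegral.integral_congr fun x _ => ?_
    simp only [Nat.sub_self, Nat.sub_zero]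
    rw [inner_toEuclideanLin, hM, map_smul, LinearMap.smul_apply, inner_smul_right,
      real_inner_comm]
  have htel : ∀ m, ∑ i ∈ Finset.range m, (-1 : ℝ) ^ i * (c i + c (i + 1)) =
      c 0 - (-1) ^ m * c m := by
    intro m
    induction m with
    | zero => simp
    | succ m ih => rw [Finset.sum_range_succ, ih, pow_succ]; ring
  rw [← Finset.sum_sub_distrib]
  simp only [← mul_sub]
  rw [← Finset.sum_congr rfl fun i hi =>
      congrArg (fun z => (-1 : ℝ) ^ i * z) (hstep i hi), htel, hend, ← mul_assoc, ← pow_add,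
    show k + 1 + (k + 2) = 2 * (k + 1) + 1 by ring, pow_succ, pow_mul]
  simp only [c, Nat.sub_zero]
  norm_num
  ring

/-- Green's identity: the boundary terms of all orders `k = i + j + 1` are collected in one double
sum. The skew matrix `P 0` contributes nothing. -/
theorem IsSobolevChain.green (hY : IsSobolevChain a b n Y) (hab : a ≤ b)
    (hP : ∀ j ≤ n, (P j).transpose = (-1 : ℝ) ^ (j + 1) • P j) :
    2 * ∫ x in a..b, inner ℝ
        (∑ k ∈ Finset.range (n + 1), Matrix.toEuclideanCLM (𝕜 := ℝ) (P k) (Y k x)) (Y 0 x) =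
      (∑ i ∈ Finset.range n, ∑ j ∈ Finset.range (n - i),
        (-1) ^ i * inner ℝ ((P (i + j + 1)).toEuclideanLin (Y j b)) (Y i b)) -
      ∑ i ∈ Finset.range n, ∑ j ∈ Finset.range (n - i),
        (-1) ^ i * inner ℝ ((P (i + j + 1)).toEuclideanLin (Y j a)) (Y i a) := by
  have hdiag : ∀ t, ∑ i ∈ Finset.range n, ∑ j ∈ Finset.range (n - i),
        (-1) ^ i * inner ℝ ((P (i + j + 1)).toEuclideanLin (Y j t)) (Y i t) =
      ∑ k ∈ Finset.range n, ∑ i ∈ Finset.range (k + 1),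
        (-1) ^ i * inner ℝ ((P (k + 1)).toEuclideanLin (Y (k - i) t)) (Y i t) := by
    intro t
    rw [← Finset.sum_range_diag_flip]
    refine Finset.sum_congr rfl fun k _ => Finset.sum_congr rfl fun i hi => ?_
    rw [Finset.mem_range] at hi
    rw [show i + (k - i) + 1 = k + 1 by omega]
  rw [hdiag, hdiag, ← Finset.sum_sub_distrib]
  rw [← Finset.sum_congr rfl fun k hk => hY.integral_inner_term hab (Finset.mem_range.1 hk)
    (hP (k + 1) (Finset.mem_range.1 hk)), ← Finset.mul_sum]
  congr 1
  rw [← intervalIntegral.integral_finsetSum fun k hk => hY.intervalIntegrable_inner hab _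
    (Finset.mem_range.1 hk) n.zero_le]
  refine intervalIntegral.integral_congr fun x _ => ?_
  simp only [sum_inner]
  have h0 : inner ℝ (Matrix.toEuclideanCLM (𝕜 := ℝ) (P 0) (Y 0 x)) (Y 0 x) = 0 :=
    inner_toEuclideanLin_self_of_transpose_eq_neg (by simpa using hP 0 n.zero_le) (Y 0 x)
  rw [Finset.sum_range_succ', h0, add_zero]
  rfl

/-- A smooth function with prescribed derivatives at a point, as an iterated primitive. -/
theorem exists_contDiff_iteratedDeriv_eq {E : Type*} [NormedAddCommGroup E] [NormedSpace ℝ E]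
    [CompleteSpace E] (c : ℝ) (n : ℕ) (α : ℕ → E) :
    ∃ p : ℝ → E, ContDiff ℝ ∞ p ∧ ∀ k < n, iteratedDeriv k p c = α k := by
  induction n generalizing α with
  | zero => exact ⟨0, contDiff_const, fun k hk => absurd hk (Nat.not_lt_zero k)⟩
  | succ n ih =>
    obtain ⟨p, hp, hpα⟩ := ih fun k => α (k + 1)
    have hd : ∀ t, HasDerivAt (fun t => α 0 + ∫ x in c..t, p x) (p t) t := fun t =>
      ((hp.continuous.integral_hasStrictDerivAt c t).hasDerivAt).const_add _
    have hd' : deriv (fun t => α 0 + ∫ x in c..t, p x) = p := funext fun t => (hd t).deriv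
    refine ⟨_, contDiff_infty_iff_deriv.2
      ⟨fun t => (hd t).differentiableAt, by rw [hd']; exact hp⟩, ?_⟩
    intro k hk
    cases k with
    | zero => simp
    | succ k => rw [iteratedDeriv_succ', hd', hpα k (by omega)]

theorem exists_contDiff_iteratedDeriv_eq_and_eq_zero {E : Type*} [NormedAddCommGroup E]
    [NormedSpace ℝ E] [CompleteSpace E] {c c' : ℝ} (hc : c ≠ c') (n : ℕ) (α : ℕ → E) :
    ∃ p : ℝ → E, ContDiff ℝ ∞ p ∧ ∀ k < n, iteratedDeriv k p c = α k ∧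
      iteratedDeriv k p c' = 0 := by
  obtain ⟨p, hp, hpα⟩ := exists_contDiff_iteratedDeriv_eq c n α
  have hdist : 0 < dist c' c := dist_pos.2 hc.symm
  let f : ContDiffBump c := ⟨dist c' c / 4, dist c' c / 2, by linarith, by linarith⟩
  refine ⟨fun x => f x • p x, f.contDiff.smul hp, fun k hk => ⟨?_, ?_⟩⟩
  · rw [← hpα k hk]
    refine Filter.EventuallyEq.iteratedDeriv_eq k ?_
    filter_upwards [f.eventuallyEq_one] with x hx
    rw [hx]
    simp
  · have h0 : (fun x => f x • p x) =ᶠ[nhds c'] fun _ => 0 := by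
      have : (Metric.closedBall c (dist c' c / 2))ᶜ ∈ nhds c' :=
        Metric.isClosed_closedBall.isOpen_compl.mem_nhds (by
          rw [mem_compl_iff, Metric.mem_closedBall]; linarith)
      filter_upwards [this] with x hx
      rw [mem_compl_iff, Metric.mem_closedBall, not_le] at hx
      rw [f.zero_of_le_dist hx.le, zero_smul]
    rw [h0.iteratedDeriv_eq k, iteratedDeriv_const]
    simp

/-- The traces at the two end points can be prescribed independently. -/
theorem exists_isSobolevChain_trace_eq (hab : a < b) (n : ℕ)
    (α β : ℕ → EuclideanSpace ℝ (Fin d)) :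
    ∃ Y : ℕ → ℝ → EuclideanSpace ℝ (Fin d), IsSobolevChain a b n Y ∧
      ∀ k < n, Y k a = α k ∧ Y k b = β k := by
  have key : ∀ p : ℝ → EuclideanSpace ℝ (Fin d), ContDiff ℝ ∞ p →
      IsSobolevChain a b n fun k => iteratedDeriv k p := by
    intro p hp
    have hc : ∀ k, Continuous (iteratedDeriv k p) := fun k =>
      hp.continuous_iteratedDeriv k (by exact_mod_cast le_top)
    refine IsSobolevChain.of_isPrimitive hab.le (fun k _ => ?_)
      (memLp_of_continuousOn (hc n).continuousOn)
    refine IsPrimitive.of_hasDerivAt (fun t => ?_) (hc (k + 1))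
    rw [iteratedDeriv_succ]
    exact (hp.differentiable_iteratedDeriv k
      (by exact_mod_cast WithTop.coe_lt_top _) t).hasDerivAt
  obtain ⟨p, hp, hpα⟩ := exists_contDiff_iteratedDeriv_eq_and_eq_zero hab.ne n α
  obtain ⟨q, hq, hqβ⟩ := exists_contDiff_iteratedDeriv_eq_and_eq_zero hab.ne' n β
  refine ⟨_, (key p hp).add (key q hq), fun k hk => ⟨?_, ?_⟩⟩
  · rw [Pi.add_apply, (hpα k hk).1, (hqβ k hk).2, add_zero]
  · rw [Pi.add_apply, (hpα k hk).2, (hqβ k hk).1, zero_add]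

end Green

/-! ### The port-Hamiltonian operator on its domain -/

section Operator

variable {a b : ℝ} {n d : ℕ} {P : ℕ → Matrix (Fin d) (Fin d) ℝ}
  {𝓗 : ℝ → Matrix (Fin d) (Fin d) ℝ} {u v : L2 a b d}
  {Y Z : ℕ → ℝ → EuclideanSpace ℝ (Fin d)}

theorem coeFn_mulL2 (h𝓗 : MemLInfty a b 𝓗) (u : L2 a b d) :
    mulL2 h𝓗 u =ᵐ[intervalMeasure a b] mulFun 𝓗 u := MemLp.coeFn_toLp _

theorem mulL2_add_ae_eq (h𝓗 : MemLInfty a b 𝓗) (hu : mulL2 h𝓗 u =ᵐ[intervalMeasure a b] Y 0)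
    (hv : mulL2 h𝓗 v =ᵐ[intervalMeasure a b] Z 0) :
    mulL2 h𝓗 (u + v) =ᵐ[intervalMeasure a b] Y 0 + Z 0 := by
  filter_upwards [coeFn_mulL2 h𝓗 (u + v), coeFn_mulL2 h𝓗 u, coeFn_mulL2 h𝓗 v, hu, hv,
    Lp.coeFn_add u v] with x h1 h2 h3 h4 h5 h6
  rw [h1, Pi.add_apply, ← h4, ← h5, h2, h3]
  simp only [mulFun]
  rw [h6, Pi.add_apply, map_add]

theorem mulL2_smul_ae_eq (h𝓗 : MemLInfty a b 𝓗) (hu : mulL2 h𝓗 u =ᵐ[intervalMeasure a b] Y 0)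
    (c : ℝ) : mulL2 h𝓗 (c • u) =ᵐ[intervalMeasure a b] c • Y 0 := by
  filter_upwards [coeFn_mulL2 h𝓗 (c • u), coeFn_mulL2 h𝓗 u, hu, Lp.coeFn_smul c u]
    with x h1 h2 h3 h4
  rw [h1, Pi.smul_apply, ← h3, h2]
  simp only [mulFun]
  rw [h4, Pi.smul_apply, map_smul]

theorem IsSobolevChain.coeFn_sum_ae_eq {y : L2 a b d} (hY : IsSobolevChain a b n Y) (hab : a ≤ b)
    (hy : y =ᵐ[intervalMeasure a b] Y 0) :
    ((∑ k ∈ Finset.range (n + 1), (Matrix.toEuclideanCLM (𝕜 := ℝ) (P k)).compLp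
        (weakDeriv a b k y) : L2 a b d) : ℝ → EuclideanSpace ℝ (Fin d))
      =ᵐ[intervalMeasure a b] fun x =>
        ∑ k ∈ Finset.range (n + 1), Matrix.toEuclideanCLM (𝕜 := ℝ) (P k) (Y k x) := by
  have key : ∀ m ≤ n + 1, ((∑ k ∈ Finset.range m, (Matrix.toEuclideanCLM (𝕜 := ℝ) (P k)).compLp
        (weakDeriv a b k y) : L2 a b d) : ℝ → EuclideanSpace ℝ (Fin d))
      =ᵐ[intervalMeasure a b] fun x =>
        ∑ k ∈ Finset.range m, Matrix.toEuclideanCLM (𝕜 := ℝ) (P k) (Y k x) := by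
    intro m
    induction m with
    | zero =>
      intro _
      simp only [Finset.range_zero, Finset.sum_empty]
      exact Lp.coeFn_zero _ _ _
    | succ m ih =>
      intro hm
      simp only [Finset.sum_range_succ]
      filter_upwards [Lp.coeFn_add (∑ k ∈ Finset.range m,
          (Matrix.toEuclideanCLM (𝕜 := ℝ) (P k)).compLp (weakDeriv a b k y))
          ((Matrix.toEuclideanCLM (𝕜 := ℝ) (P m)).compLp (weakDeriv a b m y)),
        ih (by omega), ContinuousLinearMap.coeFn_compLp (Matrix.toEuclideanCLM (𝕜 := ℝ) (P m))
          (weakDeriv a b m y), hY.weakDeriv_ae_eq hab hy (k := m) (by omega)] with x h1 h2 h3 h4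
      rw [h1, Pi.add_apply, h2, h3, h4]
  exact key (n + 1) le_rfl

theorem weightedInner_neg_left (u : L2 a b d) :
    weightedInner a b 𝓗 (-u) u = -weightedInner a b 𝓗 u u := by
  unfold weightedInner
  rw [← integral_neg]
  refine integral_congr_ae ?_
  filter_upwards [Lp.coeFn_neg u] with x hx
  rw [hx, Pi.neg_apply, map_neg, inner_neg_left]

theorem weightedInner_self_pos (h𝓗 : MemLInfty a b 𝓗) {c : ℝ} (hc : 0 < c)
    (h𝓗c : ∀ᵐ x ∂(intervalMeasure a b),
      ∀ v : EuclideanSpace ℝ (Fin d), c * ‖v‖ ^ 2 ≤ inner ℝ ((𝓗 x).toEuclideanLin v) v)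
    (hu : u ≠ 0) : 0 < weightedInner a b 𝓗 u u := by
  have h1 : 0 < c * inner ℝ u u := mul_pos hc (real_inner_self_pos.2 hu)
  refine h1.trans_le ?_
  rw [L2.inner_def, ← integral_const_mul]
  refine integral_mono_ae ((L2.integrable_inner (𝕜 := ℝ) u u).const_mul c)
    (integrable_inner_of_memLp (memLp_mulFun h𝓗 u) (Lp.memLp u)) ?_
  filter_upwards [h𝓗c] with x hx
  rw [real_inner_self_eq_norm_sq]
  exact hx (u x)

/-- The domain of the port-Hamiltonian operator as a subspace of `L₂(a,b)^d`. -/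
noncomputable def portDomain (hab : a < b) (n : ℕ) (h𝓗 : MemLInfty a b 𝓗) :
    Submodule ℝ (L2 a b d) where
  carrier := {u | MemSobolev a b n (mulL2 h𝓗 u)}
  add_mem' := fun {u v} hu hv => by
    obtain ⟨Y, hY, hu⟩ := MemSobolev.exists_isSobolevChain hab hu
    obtain ⟨Z, hZ, hv⟩ := MemSobolev.exists_isSobolevChain hab hv
    exact (hY.add hZ).memSobolev hab.le (mulL2_add_ae_eq h𝓗 hu hv)
  zero_mem' := by
    have h : IsSobolevChain a b n fun _ => (0 : ℝ → EuclideanSpace ℝ (Fin d)) :=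
      ⟨fun _ _ => ⟨by simp [Pi.zero_def], fun _ _ => by simp⟩, fun _ _ => MemLp.zero'⟩
    refine h.memSobolev hab.le ?_
    filter_upwards [coeFn_mulL2 h𝓗 0, Lp.coeFn_zero (EuclideanSpace ℝ (Fin d)) 2
      (intervalMeasure a b)] with x h1 h2
    rw [h1, mulFun, h2]
    simp
  smul_mem' := fun c u hu => by
    obtain ⟨Y, hY, hu⟩ := MemSobolev.exists_isSobolevChain hab hu
    exact (hY.const_smul c).memSobolev hab.le (mulL2_smul_ae_eq h𝓗 hu c)

variable (hab : a < b) (h𝓗 : MemLInfty a b 𝓗)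

theorem exists_isSobolevChain_of_mem (u : portDomain hab n h𝓗) :
    ∃ Y, IsSobolevChain a b n Y ∧ mulL2 h𝓗 (u : L2 a b d) =ᵐ[intervalMeasure a b] Y 0 :=
  MemSobolev.exists_isSobolevChain hab u.2

/-- The trace `u ↦ tr_t (𝓗 u)` as a linear map. -/
noncomputable def traceLin (n : ℕ) {t : ℝ} (ht : t ∈ Icc a b) :
    portDomain hab n h𝓗 →ₗ[ℝ] BoundarySpace n d where
  toFun u := trace a b n t (mulL2 h𝓗 u)
  map_add' u v := by
    obtain ⟨Y, hY, hu⟩ := exists_isSobolevChain_of_mem hab h𝓗 u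
    obtain ⟨Z, hZ, hv⟩ := exists_isSobolevChain_of_mem hab h𝓗 v
    rw [hY.trace_eq hab hu ht, hZ.trace_eq hab hv ht, Submodule.coe_add,
      (hY.add hZ).trace_eq hab (mulL2_add_ae_eq h𝓗 hu hv) ht]
    rfl
  map_smul' c u := by
    obtain ⟨Y, hY, hu⟩ := exists_isSobolevChain_of_mem hab h𝓗 u
    rw [hY.trace_eq hab hu ht, Submodule.coe_smul,
      (hY.const_smul c).trace_eq hab (mulL2_smul_ae_eq h𝓗 hu c) ht]
    rfl

/-- The port-Hamiltonian operator as a linear map on its domain. -/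
noncomputable def portLin (P : ℕ → Matrix (Fin d) (Fin d) ℝ) (n : ℕ) :
    portDomain hab n h𝓗 →ₗ[ℝ] L2 a b d where
  toFun u := ∑ k ∈ Finset.range (n + 1),
    (Matrix.toEuclideanCLM (𝕜 := ℝ) (P k)).compLp (weakDeriv a b k (mulL2 h𝓗 u))
  map_add' u v := by
    obtain ⟨Y, hY, hu⟩ := exists_isSobolevChain_of_mem hab h𝓗 u
    obtain ⟨Z, hZ, hv⟩ := exists_isSobolevChain_of_mem hab h𝓗 v
    refine Lp.ext ?_
    filter_upwards [hY.coeFn_sum_ae_eq (P := P) hab.le hu, hZ.coeFn_sum_ae_eq (P := P) hab.le hv,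
      (hY.add hZ).coeFn_sum_ae_eq (P := P) hab.le (mulL2_add_ae_eq h𝓗 hu hv),
      Lp.coeFn_add (∑ k ∈ Finset.range (n + 1),
        (Matrix.toEuclideanCLM (𝕜 := ℝ) (P k)).compLp (weakDeriv a b k (mulL2 h𝓗 u)))
        (∑ k ∈ Finset.range (n + 1),
        (Matrix.toEuclideanCLM (𝕜 := ℝ) (P k)).compLp (weakDeriv a b k (mulL2 h𝓗 v)))]
      with x h1 h2 h3 h4
    rw [h4, Pi.add_apply, h1, h2, Submodule.coe_add, h3, ← Finset.sum_add_distrib]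
    simp only [Pi.add_apply, map_add]
  map_smul' c u := by
    obtain ⟨Y, hY, hu⟩ := exists_isSobolevChain_of_mem hab h𝓗 u
    refine Lp.ext ?_
    filter_upwards [hY.coeFn_sum_ae_eq (P := P) hab.le hu,
      (hY.const_smul c).coeFn_sum_ae_eq (P := P) hab.le (mulL2_smul_ae_eq h𝓗 hu c),
      Lp.coeFn_smul c (∑ k ∈ Finset.range (n + 1),
        (Matrix.toEuclideanCLM (𝕜 := ℝ) (P k)).compLp (weakDeriv a b k (mulL2 h𝓗 u)))]
      with x h1 h2 h3
    rw [RingHom.id_apply, h3, Pi.smul_apply, h1, Submodule.coe_smul, h2, Finset.smul_sum]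
    simp only [Pi.smul_apply, map_smul]

theorem two_mul_weightedInner_portLin
    (hP : ∀ j ≤ n, (P j).transpose = (-1 : ℝ) ^ (j + 1) • P j)
    (h𝓗symm : ∀ᵐ x ∂(intervalMeasure a b), (𝓗 x).IsSymm) (u : portDomain hab n h𝓗) :
    2 * weightedInner a b 𝓗 (portLin hab h𝓗 P n u) u =
      inner ℝ ((boundaryMatrix n P).toEuclideanLin (trace a b n b (mulL2 h𝓗 u)))
        (trace a b n b (mulL2 h𝓗 u)) -
      inner ℝ ((boundaryMatrix n P).toEuclideanLin (trace a b n a (mulL2 h𝓗 u)))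
        (trace a b n a (mulL2 h𝓗 u)) := by
  obtain ⟨Y, hY, hu⟩ := exists_isSobolevChain_of_mem hab h𝓗 u
  rw [hY.trace_eq hab hu (right_mem_Icc.2 hab.le), hY.trace_eq hab hu (left_mem_Icc.2 hab.le),
    inner_boundaryMatrix_apply fun k => Y k b, inner_boundaryMatrix_apply fun k => Y k a,
    ← hY.green hab.le hP, ← integral_Ioo_eq_intervalIntegral hab.le]
  congr 1
  refine integral_congr_ae ?_
  filter_upwards [hY.coeFn_sum_ae_eq (P := P) hab.le hu, hu, coeFn_mulL2 h𝓗 (u : L2 a b d), h𝓗symm]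
    with x h1 h2 h3 h4
  rw [inner_toEuclideanLin, h4.eq, ← h2, h3, ← h1]
  rfl

theorem exists_portLin_solution
    (hP : ∀ j ≤ n, (P j).transpose = (-1 : ℝ) ^ (j + 1) • P j) (hPn : (P n).det ≠ 0)
    (h𝓗symm : ∀ᵐ x ∂(intervalMeasure a b), (𝓗 x).IsSymm)
    {c : ℝ} (hc : 0 < c) (h𝓗c : ∀ᵐ x ∂(intervalMeasure a b),
      ∀ v : EuclideanSpace ℝ (Fin d), c * ‖v‖ ^ 2 ≤ inner ℝ ((𝓗 x).toEuclideanLin v) v)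
    (f : L2 a b d) (α : BoundarySpace n d) :
    ∃ u : portDomain hab n h𝓗, (u : L2 a b d) + portLin hab h𝓗 P n u = f ∧
      traceLin hab h𝓗 n (left_mem_Icc.2 hab.le) u = α := by
  obtain ⟨u, Y, hu, hY, hYa, hmul, heq⟩ := exists_resolvent_solution hab hP hPn h𝓗 h𝓗symm hc h𝓗c
    (Lp.memLp f) fun k => WithLp.toLp 2 fun r => α (k, r)
  have huY : mulL2 h𝓗 (hu.toLp u) =ᵐ[intervalMeasure a b] Y 0 := by
    filter_upwards [coeFn_mulL2 h𝓗 (hu.toLp u), hu.coeFn_toLp, hmul] with x h1 h2 h3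
    rw [h1, ← h3, mulFun, mulFun, h2]
  refine ⟨⟨hu.toLp u, hY.memSobolev hab.le huY⟩, Lp.ext ?_, ?_⟩
  · filter_upwards [heq, hu.coeFn_toLp, hY.coeFn_sum_ae_eq (P := P) hab.le huY,
      Lp.coeFn_add (hu.toLp u) (portLin hab h𝓗 P n ⟨hu.toLp u, hY.memSobolev hab.le huY⟩)]
      with x h1 h2 h3 h4
    rw [h4, Pi.add_apply, h2, ← h1]
    congr 1
  · change trace a b n a (mulL2 h𝓗 (hu.toLp u)) = α
    rw [hY.trace_eq hab huY (left_mem_Icc.2 hab.le)]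
    ext p
    rw [PiLp.toLp_apply, hYa p.1]

theorem exists_traceLin_eq {c : ℝ} (hc : 0 < c) (h𝓗c : ∀ᵐ x ∂(intervalMeasure a b),
      ∀ v : EuclideanSpace ℝ (Fin d), c * ‖v‖ ^ 2 ≤ inner ℝ ((𝓗 x).toEuclideanLin v) v)
    (α β : BoundarySpace n d) :
    ∃ u : portDomain hab n h𝓗, traceLin hab h𝓗 n (left_mem_Icc.2 hab.le) u = α ∧
      traceLin hab h𝓗 n (right_mem_Icc.2 hab.le) u = β := by
  obtain ⟨Y, hY, hYab⟩ := exists_isSobolevChain_trace_eq hab n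
    (fun k => if h : k < n then WithLp.toLp 2 fun r : Fin d => α (⟨k, h⟩, r) else 0)
    (fun k => if h : k < n then WithLp.toLp 2 fun r : Fin d => β (⟨k, h⟩, r) else 0)
  have hu := (h𝓗.inv hc h𝓗c).memLp_mulFun (hY.2 0 n.zero_le)
  set u := mulFun (fun x => (𝓗 x)⁻¹) (Y 0) with hudef
  have huY : mulL2 h𝓗 (hu.toLp u) =ᵐ[intervalMeasure a b] Y 0 := by
    filter_upwards [coeFn_mulL2 h𝓗 (hu.toLp u), hu.coeFn_toLp, h𝓗c] with x h1 h2 h3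
    rw [h1, mulFun, h2]
    simp only [hudef, mulFun]
    rw [toEuclideanLin_toEuclideanLin, Matrix.mul_nonsing_inv _ (isUnit_det_of_coercive hc h3),
      toEuclideanLin_one_apply]
  refine ⟨⟨hu.toLp u, hY.memSobolev hab.le huY⟩, ?_, ?_⟩
  · change trace a b n a (mulL2 h𝓗 (hu.toLp u)) = α
    rw [hY.trace_eq hab huY (left_mem_Icc.2 hab.le)]
    ext p
    rw [PiLp.toLp_apply, (hYab p.1 p.1.2).1, dif_pos p.1.2]
  · change trace a b n b (mulL2 h𝓗 (hu.toLp u)) = β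
    rw [hY.trace_eq hab huY (right_mem_Icc.2 hab.le)]
    ext p
    rw [PiLp.toLp_apply, (hYab p.1 p.1.2).2, dif_pos p.1.2]

end Operator

end PortHamiltonian

theorem theorem4p9 (a b : ℝ) (hab : a < b) (n d : ℕ)
    (P : ℕ → Matrix (Fin d) (Fin d) ℝ)
    (hP : ∀ j ≤ n, (P j).transpose = (-1 : ℝ) ^ (j + 1) • P j)
    (hPn : (P n).det ≠ 0)
    (𝓗 : ℝ → Matrix (Fin d) (Fin d) ℝ)
    (h𝓗 : MemLInfty a b 𝓗)
    (h𝓗symm : ∀ᵐ x ∂(intervalMeasure a b), (𝓗 x).IsSymm)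
    (h𝓗pos : ∃ c : ℝ, 0 < c ∧ ∀ᵐ x ∂(intervalMeasure a b),
      ∀ v : EuclideanSpace ℝ (Fin d), c * ‖v‖ ^ 2 ≤ inner ℝ ((𝓗 x).toEuclideanLin v) v)
    (B : L2 a b d →. L2 a b d)
    (hB : IsRestriction B (portOperator n P h𝓗)) :
    IsMAccretive (weightedInner a b 𝓗) B ↔
      ∃ g : BoundarySpace n d → BoundarySpace n d, LipschitzWith 1 g ∧
        B.Dom = {u : L2 a b d | u ∈ (portOperator n P h𝓗).Dom ∧
          g (Qplus n P (trace a b n b (mulL2 h𝓗 u)) + Qminus n P (trace a b n a (mulL2 h𝓗 u))) =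
            Qminus n P (trace a b n b (mulL2 h𝓗 u)) +
              Qplus n P (trace a b n a (mulL2 h𝓗 u))} := by
  obtain ⟨c, hc, h𝓗c⟩ := h𝓗pos
  have hQ : (boundaryMatrix n P).toEuclideanLin.IsSymmetric :=
    Matrix.isSymmetric_toEuclideanLin_iff.2 (boundaryMatrix_isHermitian hP)
  let ta := traceLin hab h𝓗 n (left_mem_Icc.2 hab.le)
  let tb := traceLin hab h𝓗 n (right_mem_Icc.2 hab.le)
  rw [isMAccretive_iff_exists_lipschitz (ip := weightedInner a b 𝓗) (D := portDomain hab n h𝓗)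
    (A := portLin hab h𝓗 P n) (Fp := Qplus n P ∘ₗ tb + Qminus n P ∘ₗ ta)
    (Fm := Qminus n P ∘ₗ tb + Qplus n P ∘ₗ ta) weightedInner_neg_left
    (fun _ hw => weightedInner_self_pos h𝓗 hc h𝓗c hw) ta (fun w => ?_) (fun p q => ?_)
    (exists_portLin_solution hab h𝓗 hP hPn h𝓗symm hc h𝓗c) B (fun u hu => ?_)]
  · refine exists_congr fun g => and_congr_right fun _ => ?_
    have hset : {u : L2 a b d | ∃ h : u ∈ portDomain hab n h𝓗,
          g ((Qplus n P ∘ₗ tb + Qminus n P ∘ₗ ta) ⟨u, h⟩) =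
            (Qminus n P ∘ₗ tb + Qplus n P ∘ₗ ta) ⟨u, h⟩} =
        {u : L2 a b d | u ∈ (portOperator n P h𝓗).Dom ∧
          g (Qplus n P (trace a b n b (mulL2 h𝓗 u)) + Qminus n P (trace a b n a (mulL2 h𝓗 u))) =
            Qminus n P (trace a b n b (mulL2 h𝓗 u)) +
              Qplus n P (trace a b n a (mulL2 h𝓗 u))} := by
      ext u
      exact ⟨fun ⟨h, hg⟩ => ⟨h, hg⟩, fun ⟨h, hg⟩ => ⟨h, hg⟩⟩
    rw [hset]
  · rw [two_mul_weightedInner_portLin hab h𝓗 hP h𝓗symm w]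
    exact (norm_sq_boundary_sub hQ _ _).symm
  · obtain ⟨x, y, hp, hq⟩ := exists_boundary_eq hQ (boundaryMatrix_injective hPn) p q
    obtain ⟨w, hwa, hwb⟩ := exists_traceLin_eq hab h𝓗 hc h𝓗c x y
    refine ⟨w, ?_, ?_⟩
    · rw [← hp, ← hwa, ← hwb]; rfl
    · rw [← hq, ← hwa, ← hwb]; rfl
  · obtain ⟨h, hBu⟩ := hB u hu
    exact ⟨h, hBu⟩
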